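/- **Setting.** All Hilbert spaces are finite-dimensional and complex, $\mathcal L(\mathcal H)$ denotes the linear operators on $\mathcal H$, and $n$ qubits form the space $(\mathbb C^2)^{\otimes n}$ with its computational basis $\{|x\rangle\}_{x\in\{0,1\}^n}$. A *quantum instrument* is a finite family $\{\Lambda_k\}_k$ of completely positive linear maps $\mathcal L(\mathcal H)\to\mathcal L(\mathcal H')$ whose sum is trace preserving. A *POVM* is a finite family of positive semidefinite operators $\{E_k\}_k$ with $\sum_kE_k=\mathbb I$; it is a *projective measurement* if moreover $E_k^2=E_k=E_k^\dagger$ for all $k$. The POVM $E^\Lambda$ *associated* with an instrument $\Lambda$ is determined by $\operatorname{Tr}[E^\Lambda_k\rho]=\operatorname{Tr}[\Lambda_k(\rho)]$ for all $k,\rho$. An instrument $\{\Lambda_k\}_{k\in K}$ is *composable from* an instrument $\{\Gamma_l\}_{l}$ with the same input space if for every $l$ there is an instrument $\{\Theta_{k|l}\}_{k\in\widetilde K}$, $\widetilde K\supseteq K$ finite and independent of $l$, such that $\Lambda_k=\sum_l\Theta_{k|l}\circ\Gamma_l$ for all $k\in K$. For POVMs $E$, $F$ we write $E\leftarrow F$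 if the instrument $\{\rho\mapsto\operatorname{Tr}[E_k\rho]\}_k$ is composable from $\{\rho\mapsto\operatorname{Tr}[F_l\rho]\}_l$ (both with output space $\mathbb C$). A POVM $\{E_k\}_k$ on $\mathcal H_A\otimes\mathcal H_B$ *satisfies the outcome no-signaling condition from $B$*, $B\nrightarrow\mathrm{cl}$, if there is a POVM $\{F_k\}_k$ on $\mathcal H_A$ with $\operatorname{Tr}[E_k\rho]=\operatorname{Tr}[F_k\operatorname{Tr}_B\rho]$ for all $k$ and all $\rho$. **Implementability.** Let $\Lambda=\{\Lambda_k\}_{k\in K}$ be an instrument from $n$ qubits to $p$ qubits. It is *$m$-qubit implementable with delayed inputs* if $p\le m$ and $\Lambda$ is realised by a finite sequence of elementary operations of the following kind. The state consists of a classical value from a finite set, of $m$ available qubits, and of a notional system that holds the input qubits not loaded yet; it is described by a family of unnormalised states $\{\rho_k\}$ indexed by the classical value. At the start the classical value is fixed, the available qubits are in $|0\rangle^{\otimes m}$, and no input qubit is loaded. The elementary operations are: 1. *unitary*: $\rho_k\mapsto U_k\rho_kU_k^\dagger$ with a unitary $U_k$ on the $m$ available qubits; 2. *computational basis measurement* of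 a set $S(k)$ of available qubits: the classical value $k$ is replaced by $kx$ with $x\in\{0,1\}^{S(k)}$, and $\rho_{kx}=M_x\rho_kM_x^\dagger$ with $M_x=|0\rangle\langle x|_{S(k)}\otimes\mathbb I$; 3. *classical processing* by a function $f$: $\rho_{k'}=\sum_{k\in f^{-1}(k')}\rho_k$; 4. *input loading*: for a set $J$ of unloaded input qubits that does not depend on the classical value, and a set $S(k)$ of available qubits with $|S(k)|=|J|$, $k$ is replaced by $kx$ with $x\in\{0,1\}^{S(k)}$, and $\rho_{kx}=(\langle x|_{S(k)}\otimes\mathbb I)\rho_k(|x\rangle_{S(k)}\otimes\mathbb I)$; the qubits in $J$ then take the places $S(k)$ among the $m$ available qubits and are no longer unloaded. At the end all the input qubits are loaded, and for each $k\in K$ the operator $\Lambda_k(\rho)$ is obtained from the final state with classical value $k$ by tracing out $m-p$ of the $m$ available qubits, the remaining ones being identified with the $p$ output qubits; the final set of classical values may be larger than $K$. **Theorem.** Let $n_{\mathrm{in}},n_{\mathrm{out}}\in\mathbb N$, let $\mathcal H_{\mathrm{in}}=(\mathbb C^2)^{\otimes n_{\mathrm{in}}}$, $\mathcal H_{\mathrm{out}}=(\mathbb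 C^2)^{\otimes n_{\mathrm{out}}}$, let $\mathcal H_R$ be a space of qubits, and let $U:\mathcal H_{\mathrm{in}}\to\mathcal H_R\otimes\mathcal H_{\mathrm{out}}$ be unitary. Let $\Lambda=\{\Lambda_k\}_k$ be the instrument $$\Lambda_k(\rho)=\operatorname{Tr}_R\big[(|k\rangle\langle k|_R\otimes\mathbb I_{\mathrm{out}})\,U\rho\,U^\dagger\big],$$ where $k$ runs over the computational basis labels of $\mathcal H_R$. Let $T\in\mathbb N$, let $A_1,\dots,A_T$ be distinct input qubits, and suppose that there are projective measurements $E^{(1)},\dots,E^{(T)}$ on $\mathcal H_{\mathrm{in}}$ such that * $E^{(1)}\leftarrow E^{(2)}\leftarrow\cdots\leftarrow E^{(T)}\leftarrow E^{\Lambda}$; * for each $t$, $E^{(t)}$ satisfies the outcome no-signaling condition $A_t\nrightarrow\mathrm{cl}$; * for each $t$, every element of $E^{(t)}$ has rank exactly $2^{\,n_{\mathrm{in}}-t}$. Then $\Lambda$ is $(n_{\mathrm{in}}-T)$-qubit implementable with delayed inputs. -/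

import Mathlib

namespace QubitSpace

open Matrix
open scoped Kronecker ComplexOrder

/-! ### Operators, partial traces, qubit registers

`L a` is the space of linear operators on the Hilbert space with orthonormal basis indexed by `a`;
the tensor product of two such spaces has basis `a × b`. A register of qubits labelled by `ι`
has the computational basis `ι → Bool`, where `false` stands for `0` and `true` for `1`. -/

/-- Linear operators on the Hilbert space `ℂ^a`. -/
abbrev L (a : Type) : Type := Matrix a a ℂ

/-- Computational basis labels (bit strings) of a register of qubits labelled by `ι`. -/
abbrev Bits (ι : Type) : Type := ι → Bool

section General

variable {a b c κ ℓ : Type}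

/-- The map `ρ ↦ A ρ A†`. -/
def conjMap [Fintype b] (A : Matrix a b ℂ) : L b →ₗ[ℂ] L a where
  toFun ρ := A * ρ * Aᴴ
  map_add' ρ σ := by rw [Matrix.mul_add, Matrix.add_mul]
  map_smul' z ρ := by simp

/-- `Tr_B` on operators on `A ⊗ B`. -/
def ptraceRight [Fintype b] : L (a × b) →ₗ[ℂ] L a where
  toFun ρ := Matrix.of fun i j => ∑ x : b, ρ (i, x) (j, x)
  map_add' ρ σ := by ext i j; simp [Finset.sum_add_distrib]
  map_smul' z ρ := by ext i j; simp [Finset.mul_sum]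

/-- `Tr_A` on operators on `A ⊗ B`. -/
def ptraceLeft [Fintype a] : L (a × b) →ₗ[ℂ] L b where
  toFun ρ := Matrix.of fun i j => ∑ x : a, ρ (x, i) (x, j)
  map_add' ρ σ := by ext i j; simp [Finset.sum_add_distrib]
  map_smul' z ρ := by ext i j; simp [Finset.mul_sum]

/-- Change of basis labels along a bijection, on operators. -/
def relabel (e : a ≃ b) : L a →ₗ[ℂ] L b :=
  (Matrix.reindexLinearEquiv ℂ ℂ e e).toLinearMap

/-! ### Instruments and POVMs -/

/-- The ampliation `id_n ⊗ Φ`. -/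
def ampliate (n : ℕ) (Φ : L a →ₗ[ℂ] L b) (M : L (Fin n × a)) : L (Fin n × b) :=
  Matrix.of fun p q => Φ (Matrix.of fun i j => M (p.1, i) (q.1, j)) p.2 q.2

/-- Complete positivity. -/
def IsCP (Φ : L a →ₗ[ℂ] L b) : Prop :=
  ∀ (n : ℕ) (M : L (Fin n × a)), M.PosSemidef → (ampliate n Φ M).PosSemidef

/-- A quantum instrument: completely positive maps whose sum is trace preserving
(each of them is then trace nonincreasing on positive operators). -/
def IsInstrument [Fintype κ] [Fintype a] [Fintype b] (Λ : κ → (L a →ₗ[ℂ] L b)) : Prop :=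
  (∀ k, IsCP (Λ k)) ∧ ∀ ρ, ∑ k, (Λ k ρ).trace = ρ.trace

/-- A positive operator-valued measure. -/
def IsPOVM [Fintype κ] [DecidableEq a] (E : κ → L a) : Prop :=
  (∀ k, (E k).PosSemidef) ∧ ∑ k, E k = 1

/-- A projective measurement: a POVM all of whose elements are orthogonal projectors. -/
def IsProjectiveMeasurement [Fintype κ] [Fintype a] [DecidableEq a] (E : κ → L a) : Prop :=
  IsPOVM E ∧ ∀ k, E k * E k = E k ∧ (E k)ᴴ = E k

/-- A POVM regarded as an instrument with trivial quantum output `ℂ`: `ρ ↦ Tr[E_k ρ]`. -/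
def povmInstr [Fintype a] (E : κ → L a) (k : κ) : L a →ₗ[ℂ] L Unit where
  toFun ρ := Matrix.of fun _ _ => (E k * ρ).trace
  map_add' ρ σ := by ext i j; simp [Matrix.mul_add]
  map_smul' z ρ := by ext i j; simp

/-- The POVM associated with an instrument, characterised by `Tr[E_k ρ] = Tr[Λ_k(ρ)]`
(see `assocPOVM_spec` and `assocPOVM_unique`). -/
def assocPOVM [DecidableEq a] [Fintype b] (Λ : κ → (L a →ₗ[ℂ] L b)) (k : κ) : L a :=
  Matrix.of fun i j => (Λ k (Matrix.single j i 1)).trace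

theorem assocPOVM_spec [Fintype a] [DecidableEq a] [Fintype b]
    (Λ : κ → (L a →ₗ[ℂ] L b)) (k : κ) (ρ : L a) :
    (assocPOVM Λ k * ρ).trace = (Λ k ρ).trace := by
  conv_rhs => rw [Matrix.matrix_eq_sum_single ρ]
  have h : ∀ i j, Matrix.single i j (ρ i j) = ρ i j • Matrix.single i j (1 : ℂ) := by
    intro i j; simp
  simp only [h, map_sum, map_smul, Matrix.trace_sum, Matrix.trace_smul]
  rw [Matrix.trace]
  simp only [Matrix.diag, Matrix.mul_apply, assocPOVM, Matrix.of_apply, smul_eq_mul]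
  rw [Finset.sum_comm]
  exact Finset.sum_congr rfl fun i _ => Finset.sum_congr rfl fun j _ => mul_comm _ _

theorem assocPOVM_unique [Fintype a] [DecidableEq a] [Fintype b]
    (Λ : κ → (L a →ₗ[ℂ] L b)) (E : κ → L a)
    (h : ∀ k ρ, (E k * ρ).trace = (Λ k ρ).trace) : E = assocPOVM Λ := by
  funext k
  ext i j
  have := h k (Matrix.single j i 1)
  rw [Matrix.trace_mul_single] at this
  simpa [assocPOVM] using this

/-- `Λ` is composable from `Γ`: for each outcome `l` of `Γ` there is an instrument `Θ_{· | l}` with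
`Λ_k = ∑_l Θ_{k | l} ∘ Γ_l`. The outcome set `κ ⊕ Fin e` of the `Θ_{· | l}` may be larger than the
outcome set `κ` of `Λ`. -/
def Composable [Fintype κ] [Fintype ℓ] [Fintype b] [Fintype c]
    (Γ : ℓ → (L a →ₗ[ℂ] L b)) (Λ : κ → (L a →ₗ[ℂ] L c)) : Prop :=
  ∃ (e : ℕ) (Θ : ℓ → (κ ⊕ Fin e) → (L b →ₗ[ℂ] L c)),
    (∀ l, IsInstrument (Θ l)) ∧
      ∀ k ρ, Λ k ρ = ∑ l, Θ l (Sum.inl k) (Γ l ρ)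

/-- Composability of POVMs: `E` is composable from `F`. -/
def POVMComposable [Fintype κ] [Fintype ℓ] [Fintype a] (F : ℓ → L a) (E : κ → L a) : Prop :=
  Composable (povmInstr F) (povmInstr E)

/-- Outcome no-signaling from `B` for a POVM on a system `h` split as `A ⊗ B` by `s`: the
outcome probabilities are those of a POVM `F` on `A` applied to the marginal state on `A`. -/
def OutcomeNoSignaling {h : Type} [Fintype κ] [Fintype h] [Fintype a] [DecidableEq a] [Fintype b]
    (s : h ≃ a × b) (E : κ → L h) : Prop :=
  ∃ F : κ → L a, IsPOVM F ∧
    ∀ k ρ, (E k * ρ).trace = (F k * ptraceRight (relabel s ρ)).trace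

end General

/-- The splitting of a qubit register into all the qubits other than `q`, and the qubit `q`. -/
def splitQubit {n : ℕ} (q : Fin n) :
    Bits (Fin n) ≃ Bits {i : Fin n // i ≠ q} × Bits {i : Fin n // ¬ i ≠ q} :=
  Equiv.piEquivPiSubtypeProd (fun i => i ≠ q) (fun _ => Bool)

/-- Outcome no-signaling of a POVM on `n` qubits from the qubit `q`. -/
def NoSignalingFromQubit {n : ℕ} {κ : Type} [Fintype κ] (q : Fin n)
    (E : κ → L (Bits (Fin n))) : Prop :=
  OutcomeNoSignaling (splitQubit q) E

/-- The instrument `Λ_k(ρ) = Tr_R[(|k⟩⟨k|_R ⊗ I_out) U ρ U†]`. -/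
def unitaryMeasureInstr {h r o : Type} [Fintype h] [Fintype r] [Fintype o] [DecidableEq r]
    [DecidableEq o] (U : Matrix (r × o) h ℂ) (k : r) : L h →ₗ[ℂ] L o :=
  ptraceLeft ∘ₗ
    LinearMap.mulLeft ℂ (Matrix.single k k (1 : ℂ) ⊗ₖ (1 : Matrix o o ℂ)) ∘ₗ conjMap U

/-! ### Circuits on `m` qubits with delayed inputs

The `m` available qubits are the slots `Fin m`. The input qubits are labelled by `Fin n`; those
that are not loaded yet form a `Finset r`. The joint system of the available
qubits and the notional system of unloaded inputs is `L (Sys m r)`. -/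

/-- Basis labels of `H_m ⊗ H_in`, where `H_in` consists of the unloaded input qubits `r`. -/
abbrev Sys (m : ℕ) {n : ℕ} (r : Finset (Fin n)) : Type := Bits (Fin m) × Bits r

/-- The measurement operator `M_x = |0⟩⟨x|_S ⊗ I` on the available qubits. -/
def measOp {m : ℕ} (S : Finset (Fin m)) (x : Bits S) : Matrix (Bits (Fin m)) (Bits (Fin m)) ℂ :=
  Matrix.of fun i j =>
    if (∀ s : S, i s = false ∧ j s = x s) ∧ (∀ s, s ∉ S → i s = j s) then 1 else 0

/-- The operator `⟨x|_S ⊗ I` on `H_m ⊗ H_in`, where `S` is the range of `σ`, followed by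
the relabelling of the systems: the new `H_m` is `H_{S^c} ⊗ H_J`, where the input qubit `j ∈ J`
occupies the slot `σ j`, and the new `H_in` consists of the remaining input qubits `r'`. -/
def loadOp {m n : ℕ} {r r' J : Finset (Fin n)} (hJ : J ⊆ r) (hr' : r' = r \ J)
    (σ : J ↪ Fin m) (x : Bits J) : Matrix (Sys m r') (Sys m r) ℂ :=
  Matrix.of fun p q =>
    if (∀ j : J, q.1 (σ j) = x j) ∧
        (∀ s, s ∉ Set.range σ → p.1 s = q.1 s) ∧
        (∀ j : J, p.1 (σ j) = q.2 ⟨j, hJ j.2⟩) ∧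
        (∀ i : r', p.2 i = q.2 ⟨i, Finset.sdiff_subset (hr'.subset i.2)⟩)
    then 1 else 0

/-- Elementary operations. `ElemOp m κ κ' r r'` consists of those that take the classical register
from the value set `κ` to the value set `κ'` and the set of unloaded input qubits from `r` to `r'`.
Everything but the set `J` of loaded input qubits may depend on the current classical value.
In `load`, the slots measured and then loaded are `S(k) = range (σ k)`, and the outcome
`x ∈ {0,1}^{S(k)}` is indexed through `σ k`. -/
inductive ElemOp (m : ℕ) {n : ℕ} :
    (κ κ' : Type) → (r r' : Finset (Fin n)) → Type 1
  | unitary {κ : Type} {r : Finset (Fin n)}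
      (U : κ → Matrix.unitaryGroup (Bits (Fin m)) ℂ) : ElemOp m κ κ r r
  | measure {κ : Type} {r : Finset (Fin n)}
      (S : κ → Finset (Fin m)) : ElemOp m κ (Σ k : κ, Bits (S k)) r r
  | classical {κ κ' : Type} {r : Finset (Fin n)}
      (f : κ → κ') : ElemOp m κ κ' r r
  | load {κ : Type} {r r' : Finset (Fin n)} (J : Finset (Fin n)) (hJ : J ⊆ r) (hr' : r' = r \ J)
      (σ : κ → (J ↪ Fin m)) : ElemOp m κ (κ × Bits J) r r'

open scoped Classical in
/-- The family of maps `Φ_{k' | k}` of an elementary operation. -/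
noncomputable def ElemOp.instr {m n : ℕ} {κ κ' : Type} {r r' : Finset (Fin n)} :
    ElemOp m κ κ' r r' → κ → κ' → (L (Sys m r) →ₗ[ℂ] L (Sys m r'))
  | .unitary (r := r) U, k, k' =>
      if k' = k then conjMap ((U k : Matrix _ _ ℂ) ⊗ₖ (1 : L (Bits r))) else 0
  | .measure (r := r) S, k, k' =>
      ∑ x : Bits (S k),
        if k' = ⟨k, x⟩ then conjMap (measOp (S k) x ⊗ₖ (1 : L (Bits r))) else 0
  | .classical f, k, k' => if k' = f k then LinearMap.id else 0
  | .load J hJ hr' σ, k, k' =>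
      ∑ x : Bits J, if k' = (k, x) then conjMap (loadOp hJ hr' (σ k) x) else 0

/-- The initial state `|0⟩⟨0|^{⊗ m} ⊗ ρ`, with all the input qubits unloaded. -/
noncomputable def initState (m n : ℕ) :
    L (Bits (Fin n)) →ₗ[ℂ] L (Sys m (Finset.univ : Finset (Fin n))) :=
  { toFun := fun σ =>
      (Matrix.single (fun _ => false) (fun _ => false) 1 : L (Bits (Fin m))) ⊗ₖ σ
    map_add' := fun σ τ => Matrix.kronecker_add _ σ τ
    map_smul' := fun z σ => Matrix.kronecker_smul z _ σ } ∘ₗ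
    relabel (Equiv.arrowCongr
      (Equiv.subtypeUnivEquiv (fun i : Fin n => Finset.mem_univ i)).symm (Equiv.refl Bool))

/-- Finite sequences of elementary operations, starting from a one-point classical register with
all the input qubits unloaded, and ending with the classical register `κ` and the unloaded input
qubits `r`. -/
inductive Circuit (m n : ℕ) : Type → Finset (Fin n) → Type 1
  | nil : Circuit m n Unit Finset.univ
  | snoc {κ κ' : Type} {r r' : Finset (Fin n)} [Fintype κ] [Fintype κ']
      (C : Circuit m n κ r) (op : ElemOp m κ κ' r r') : Circuit m n κ' r'

/-- The map `∑_{k_1, …, k_{T-1}} Φ^{(T)}_{k | k_{T-1}} ∘ ⋯ ∘ Φ^{(1)}_{k_1 | k_0}` applied to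
`|0⟩⟨0|^{⊗ m} ⊗ ρ`. -/
noncomputable def Circuit.run {m n : ℕ} {κ : Type} {r : Finset (Fin n)} :
    Circuit m n κ r → κ → (L (Bits (Fin n)) →ₗ[ℂ] L (Sys m r))
  | .nil, _ => initState m n
  | @Circuit.snoc _ _ κ₁ _ _ _ _ _ C op, k' => ∑ k : κ₁, op.instr k k' ∘ₗ C.run k

/-- The trace over the `m - p` available qubits that are not output qubits (and over the trivial
system of unloaded inputs), where `e` identifies `H_m` with `H_out ⊗ (ℂ²)^{⊗ (m - p)}`. -/
noncomputable def outTrace {m n p : ℕ} (e : Fin m ≃ Fin p ⊕ Fin (m - p)) :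
    L (Sys m (∅ : Finset (Fin n))) →ₗ[ℂ] L (Bits (Fin p)) :=
  ptraceRight (a := Bits (Fin p)) (b := Bits (Fin (m - p))) ∘ₗ
    relabel ((Equiv.arrowCongr e (Equiv.refl Bool)).trans
      (Equiv.sumArrowEquivProdArrow (Fin p) (Fin (m - p)) Bool)) ∘ₗ
    ptraceRight (a := Bits (Fin m)) (b := Bits (∅ : Finset (Fin n)))

/-- `Λ` is an `m`-qubit implementable instrument (with delayed inputs): it is an instrument that is
realised by a circuit on `m` qubits that loads all the input qubits. The final outcome set
`κ'` of the circuit may be larger than the outcome set `κ` of `Λ`. -/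
def DelayedImplementable (m : ℕ) {n p : ℕ} {κ : Type} [Fintype κ]
    (Λ : κ → (L (Bits (Fin n)) →ₗ[ℂ] L (Bits (Fin p)))) : Prop :=
  IsInstrument Λ ∧
    ∃ (κ' : Type) (ι : κ ↪ κ') (C : Circuit m n κ' ∅) (e : Fin m ≃ Fin p ⊕ Fin (m - p)),
      ∀ k ρ, Λ k ρ = outTrace e (C.run (ι k) ρ)

end QubitSpace

/-!
Every `E t k` has rank `2 ^ (n - (t + 1))`, where `n` is the number of input qubits and `t` counts
from `0`. Composability of projective measurements without zero elements is deterministic: each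
element of the coarser one is a sum of elements of the finer one
(`POVMComposable.exists_coarseGraining`). By the ranks, each element of `E t` splits into exactly two
elements of `E (t + 1)`. No-signaling from `A t` means that the elements of `E t` are of the form
`F ⊗ I` with `I` on the qubit `A t`. Since sums preserve this form, `E t` acts trivially on all the
qubits `A t, A (t + 1), …` (`intertwines_of_chain`).

The circuit first loads the `m = n - T` inputs that are not among the `A t`
(`compresses_one`). It then performs `E 0, E 1, …` in turn, so that after the outcome `k` the range of
`E t k` is mapped unitarily onto the space of the `m` available qubits and the inputs `A s`, `s > t`,
with the identity on the latter (`Compresses`). Given such a compression for one measurement, the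
next one becomes a measurement of the `m` available qubits alone, with two projectors of
rank `2 ^ (m - 1)`. A unitary on the available qubits turns it into the computational basis
measurement of a single slot, after which the slot is free to receive the next input
(`Compresses.refine`).

After `T` rounds nothing is left unloaded. The elements associated with the instrument have rank
`2 ^ p`, with `p` the number of output qubits, and those below the observed outcome become orthogonal
projectors on the `m` qubits that sum to the identity. One more unitary makes them the computational
basis measurement of `m - p` qubits, and takes the output to the other `p` qubits
(`Compresses.delayedImplementable`).
-/

namespace QubitSpace

open Matrix
open scoped Kronecker ComplexOrder

/-! ### Projectors and projective measurements -/

section Projections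

variable {a o κ ℓ : Type} [Fintype a] [DecidableEq a]

theorem eigenvalues_eq_one_of_ne_zero {P : L a} (hP : P.IsHermitian) (hPP : P * P = P) (i : a)
    (hi : hP.eigenvalues i ≠ 0) : hP.eigenvalues i = 1 := by
  have h := hP.conjStarAlgAut_star_eigenvectorUnitary
  have h2 := congrArg₂ (· * ·) h h
  simp only [← map_mul, hPP] at h2
  rw [h, diagonal_mul_diagonal] at h2
  have h3 := congrFun (diagonal_injective h2) i
  simp only [Function.comp_apply] at h3
  have h4 : hP.eigenvalues i = hP.eigenvalues i * hP.eigenvalues i := by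
    exact_mod_cast h3
  exact (mul_left_cancel₀ hi (by rw [mul_one]; exact h4)).symm

/-- An orthogonal projector is `V† V` for a coisometry `V`, whose rows are conjugates of
the eigenvectors with nonzero eigenvalue. -/
theorem exists_coisometry_eigenvalues {P : L a} (hP : P.IsHermitian) (hPP : P * P = P) :
    ∃ V : Matrix {i // hP.eigenvalues i ≠ 0} a ℂ, V * Vᴴ = 1 ∧ Vᴴ * V = P := by
  classical
  refine ⟨((hP.eigenvectorUnitary : L a)ᴴ).submatrix Subtype.val id, ?_, ?_⟩
  · have h : (hP.eigenvectorUnitary : L a)ᴴ * (hP.eigenvectorUnitary : L a) = 1 :=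
      (mem_unitaryGroup_iff'.1 hP.eigenvectorUnitary.2)
    rw [conjTranspose_submatrix, conjTranspose_conjTranspose,
      submatrix_mul _ _ _ id _ Function.bijective_id |>.symm, h]
    ext i j
    simp [one_apply, Subtype.ext_iff]
  · have h := hP.spectral_theorem
    rw [Unitary.conjStarAlgAut_apply] at h
    conv_rhs => rw [h]
    ext i j
    rw [mul_apply, mul_apply]
    simp only [conjTranspose_apply, submatrix_apply, id, mul_diagonal, star_star,
      Function.comp_apply, star_apply]
    rw [← Finset.sum_filter_add_sum_filter_not Finset.univ (fun x => hP.eigenvalues x ≠ 0),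
      Finset.sum_subtype (Finset.univ.filter fun x => hP.eigenvalues x ≠ 0)
        (p := fun x => hP.eigenvalues x ≠ 0) (by simp),
      Finset.sum_eq_zero (s := Finset.univ.filter fun x => ¬hP.eigenvalues x ≠ 0)
        (fun x hx => by
          have hx' : hP.eigenvalues x = 0 := not_not.1 (Finset.mem_filter.1 hx).2
          simp [hx']), add_zero]
    refine Finset.sum_congr rfl fun x _ => ?_
    simp [eigenvalues_eq_one_of_ne_zero hP hPP x x.2]

theorem trace_eq_rank {P : L a} (hP : P.IsHermitian) (hPP : P * P = P) :
    P.trace = (P.rank : ℂ) := by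
  obtain ⟨V, hV, hV'⟩ := exists_coisometry_eigenvalues hP hPP
  calc P.trace = (Vᴴ * V).trace := by rw [hV']
    _ = (P.rank : ℂ) := by
      rw [trace_mul_comm, hV, trace_one, hP.rank_eq_card_non_zero_eigs]

theorem exists_coisometry [Fintype o] [DecidableEq o] {P : L a} (hP : P.IsHermitian)
    (hPP : P * P = P) (h : P.trace = Fintype.card o) :
    ∃ V : Matrix o a ℂ, V * Vᴴ = 1 ∧ Vᴴ * V = P := by
  obtain ⟨V, hV, hV'⟩ := exists_coisometry_eigenvalues hP hPP
  have hc : Fintype.card o = Fintype.card {i // hP.eigenvalues i ≠ 0} := by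
    have h' : (Vᴴ * V).trace = Fintype.card o := by rw [hV', h]
    rw [trace_mul_comm, hV, trace_one] at h'
    exact_mod_cast h'.symm
  let e := Fintype.equivOfCardEq hc
  refine ⟨V.submatrix e id, ?_, ?_⟩
  · rw [conjTranspose_submatrix, ← submatrix_mul _ _ _ id _ Function.bijective_id, hV,
      submatrix_one_equiv]
  · rw [conjTranspose_submatrix, ← submatrix_mul _ _ _ e _ e.bijective, hV', submatrix_id_id]

/-- The elements of a projective measurement are mutually orthogonal: since they sum to `1`, the squared
Hilbert-Schmidt norms of `E k * E j` over all `k` add up to that of `E j * E j` alone. -/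
theorem IsProjectiveMeasurement.mul_eq_zero [Fintype κ] {E : κ → L a}
    (hE : IsProjectiveMeasurement E) {i j : κ} (hij : i ≠ j) : E i * E j = 0 := by
  classical
  have hsum : ∑ k, ((E k * E j)ᴴ * (E k * E j)).trace = (E j).trace := by
    have h : ∀ k, (E k * E j)ᴴ * (E k * E j) = E j * E k * E j := fun k => by
      rw [conjTranspose_mul, (hE.2 k).2, (hE.2 j).2, Matrix.mul_assoc, ← Matrix.mul_assoc (E k),
        (hE.2 k).1, Matrix.mul_assoc]
    simp only [h]
    rw [← trace_sum, ← Finset.sum_mul, ← Finset.mul_sum, hE.1.2, Matrix.mul_one, (hE.2 j).1]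
  rw [← Finset.add_sum_erase _ _ (Finset.mem_univ j), (hE.2 j).1, (hE.2 j).2, (hE.2 j).1,
    add_eq_left, Finset.sum_eq_zero_iff_of_nonneg
      fun k _ => (posSemidef_conjTranspose_mul_self _).trace_nonneg] at hsum
  exact trace_conjTranspose_mul_self_eq_zero_iff.1
    (hsum i (Finset.mem_erase.2 ⟨hij, Finset.mem_univ i⟩))

theorem ext_trace {M N : L a} (h : ∀ ρ, (M * ρ).trace = (N * ρ).trace) : M = N := by
  ext i j
  simpa [trace_mul_single] using h (single j i 1)

/-- Composability of a projective measurement `E` from a projective measurement `F` without zero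
elements is deterministic: multiplying `E k = ∑ l, θ(k|l) F l` by `F l` shows that each `θ(k|l)` is
idempotent, and they sum to `1` over `k`, so that exactly one of them is `1`. -/
theorem POVMComposable.exists_coarseGraining [Fintype κ] [Fintype ℓ] [DecidableEq κ] {F : ℓ → L a}
    {E : κ → L a} (h : POVMComposable F E) (hF : IsProjectiveMeasurement F)
    (hE : IsProjectiveMeasurement E) (hF0 : ∀ l, F l ≠ 0) :
    ∃ f : ℓ → κ, ∀ k, E k = ∑ l with f l = k, F l := by
  obtain ⟨e, Θ, -, hΘ⟩ := h
  let θ : κ → ℓ → ℂ := fun k l => Θ l (Sum.inl k) 1 () ()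
  have hEθ : ∀ k, E k = ∑ l, θ k l • F l := fun k => ext_trace fun ρ => by
    have h1 := congrFun (congrFun (hΘ k ρ) ()) ()
    have h2 : ∀ l, povmInstr F l ρ = (F l * ρ).trace • (1 : L Unit) := fun l => by
      ext i j; simp [povmInstr]
    simp only [h2, map_smul, Matrix.sum_apply, Matrix.smul_apply] at h1
    simp only [Finset.sum_mul, trace_sum, smul_mul, trace_smul]
    refine Eq.trans h1 (Finset.sum_congr rfl fun l _ => mul_comm _ _)
  have hmul : ∀ k l, E k * F l = θ k l • F l := fun k l => by
    rw [hEθ, Finset.sum_mul, Finset.sum_eq_single l]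
    · rw [smul_mul, (hF.2 l).1]
    · intro l' _ hl; rw [smul_mul, hF.mul_eq_zero hl, smul_zero]
    · simp
  have hidem : ∀ k l, θ k l = 0 ∨ θ k l = 1 := fun k l => by
    have h1 : (θ k l * θ k l) • F l = θ k l • F l := by
      rw [← hmul, ← (hE.2 k).1, Matrix.mul_assoc, hmul, Matrix.mul_smul, hmul, smul_smul]
    have h2 := smul_left_injective ℂ (hF0 l) h1
    by_cases h0 : θ k l = 0
    · exact Or.inl h0
    · exact Or.inr (mul_left_cancel₀ h0 (by rw [mul_one]; exact h2))
  have hsum : ∀ l, ∑ k, θ k l = 1 := fun l => by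
    refine smul_left_injective ℂ (hF0 l) ?_
    simp only [Finset.sum_smul, ← hmul, ← Finset.sum_mul, hE.1.2, Matrix.one_mul, one_smul]
  have hex : ∀ l, ∃ k, θ k l = 1 := fun l => by
    by_contra! hne
    have := hsum l
    rw [Finset.sum_eq_zero fun k _ => (hidem k l).resolve_right (hne k)] at this
    exact zero_ne_one this
  choose f hf using hex
  refine ⟨f, fun k => ?_⟩
  rw [hEθ, Finset.sum_filter]
  refine Finset.sum_congr rfl fun l _ => ?_
  split_ifs with hk
  · rw [← hk, hf, one_smul]
  · have h0 : θ k l = 0 := by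
      by_contra hne
      -- two values `1` would force `E (f l) * F l = F l = E k * F l`
      apply hF0 l
      have h1 : E k * F l = F l := by
        rw [hmul, (hidem k l).resolve_left hne, one_smul]
      have h2 : E (f l) * F l = F l := by rw [hmul, hf, one_smul]
      rw [← h2, ← h1, ← Matrix.mul_assoc, hE.mul_eq_zero hk, Matrix.zero_mul]
    rw [h0, zero_smul]

/-- Pairwise orthogonal coisometries that fill up the dimension are the blocks of a unitary. -/
theorem exists_unitary_of_coisometries {I b : Type} [Fintype b] [DecidableEq b] [Fintype o]
    [DecidableEq o] [Fintype I] [DecidableEq I]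
    (e : b ≃ I × o) (V : I → Matrix o b ℂ) (hV : ∀ i, V i * (V i)ᴴ = 1)
    (hV' : ∀ i j, i ≠ j → V i * (V j)ᴴ = 0) :
    ∃ Q : Matrix.unitaryGroup b ℂ, (∀ x y, (Q : L b) x y = V (e x).1 (e x).2 y) ∧
      ∀ i, (Q : L b)ᴴ * diagonal (fun x => if (e x).1 = i then (1 : ℂ) else 0) * (Q : L b) =
        (V i)ᴴ * V i := by
  refine ⟨⟨Matrix.of fun x y => V (e x).1 (e x).2 y, mem_unitaryGroup_iff.2 ?_⟩,
    fun _ _ => rfl, fun i => ?_⟩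
  · ext x y
    have h : ((Matrix.of fun x y => V (e x).1 (e x).2 y) *
        star (Matrix.of fun x y => V (e x).1 (e x).2 y) : L b) x y
        = (V (e x).1 * (V (e y).1)ᴴ) (e x).2 (e y).2 := rfl
    rw [h]
    by_cases hxy : (e x).1 = (e y).1
    · rw [hxy, hV, one_apply, one_apply]
      have : (e x).2 = (e y).2 ↔ x = y :=
        ⟨fun h2 => e.injective (Prod.ext hxy h2), fun h => by rw [h]⟩
      simp only [this]
    · rw [hV' _ _ hxy, one_apply_ne (fun h => hxy (by rw [h]))]; rfl
  · ext x y
    rw [Matrix.mul_apply, Matrix.mul_apply, ← Equiv.sum_comp e.symm, Fintype.sum_prod_type,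
      Finset.sum_eq_single i]
    · simp
    · intro j _ hj
      simp [hj]
    · simp

end Projections

/-! ### Operators that act trivially on a qubit -/

/-- A qubit inside a system with basis labels `P`: the bit that a label assigns to the qubit
(the operator `Z`), and the bijection of labels that flips this bit (the operator `X`). -/
structure Qubit (P : Type) where
  val : P → Bool
  flip : P ≃ P

/-- The qubit `i` of a register. -/
def Qubit.bits {ι : Type} [DecidableEq ι] (i : ι) : Qubit (Bits ι) where
  val y := y i
  flip := Function.Involutive.toPerm (fun y => Function.update y i (!y i)) fun y => by simp

theorem Qubit.bits_flip_apply {ι : Type} [DecidableEq ι] (i : ι) (y : Bits ι) :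
    (Qubit.bits i).flip y = Function.update y i (!y i) := rfl

/-- The unloaded qubit `i`, in the joint system with the available qubits. -/
def Qubit.sys (m : ℕ) {n : ℕ} {r : Finset (Fin n)} (i : r) : Qubit (Sys m r) where
  val p := p.2 i
  flip := Equiv.prodCongr (Equiv.refl _) (Qubit.bits i).flip

/-- `W` intertwines the Pauli operators `Z` and `X` of the qubit `q'` of its input with those of the
qubit `q` of its output, that is, `W` is the identity on this qubit tensored with an operator on
the rest. -/
def Intertwines {P P' : Type} (q : Qubit P) (q' : Qubit P') (W : Matrix P P' ℂ) : Prop :=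
  (∀ i j, W i j ≠ 0 → q.val i = q'.val j) ∧ ∀ i j, W (q.flip i) (q'.flip j) = W i j

namespace Intertwines

variable {P P' P'' : Type} {q : Qubit P} {q' : Qubit P'} {q'' : Qubit P''}

theorem mul [Fintype P'] {V : Matrix P P' ℂ} {W : Matrix P' P'' ℂ} (hV : Intertwines q q' V)
    (hW : Intertwines q' q'' W) : Intertwines q q'' (V * W) := by
  refine ⟨fun i j h => ?_, fun i j => ?_⟩
  · obtain ⟨k, -, hk⟩ := Finset.exists_ne_zero_of_sum_ne_zero h
    exact (hV.1 i k (left_ne_zero_of_mul hk)).trans (hW.1 k j (right_ne_zero_of_mul hk))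
  · rw [mul_apply, ← Equiv.sum_comp q'.flip]
    simp only [hV.2, hW.2]
    rfl

theorem conjTranspose {W : Matrix P P' ℂ} (hW : Intertwines q q' W) : Intertwines q' q Wᴴ :=
  ⟨fun i j h => (hW.1 j i fun h0 => h (by simp [h0])).symm,
    fun i j => by simp only [conjTranspose_apply, hW.2]⟩

theorem sum {ι : Type} (s : Finset ι) {W : ι → Matrix P P' ℂ}
    (hW : ∀ k ∈ s, Intertwines q q' (W k)) : Intertwines q q' (∑ k ∈ s, W k) := by
  refine ⟨fun i j h => ?_, fun i j => ?_⟩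
  · rw [Matrix.sum_apply] at h
    obtain ⟨k, hk, hne⟩ := Finset.exists_ne_zero_of_sum_ne_zero h
    exact (hW k hk).1 i j hne
  · simp only [Matrix.sum_apply]
    exact Finset.sum_congr rfl fun k hk => (hW k hk).2 i j

end Intertwines

theorem intertwines_kronecker_one {m n : ℕ} {r : Finset (Fin n)} (U : L (Bits (Fin m))) (i : r) :
    Intertwines (Qubit.sys m i) (Qubit.sys m i) (U ⊗ₖ (1 : L (Bits r))) := by
  refine ⟨fun p q h => ?_, fun p q => ?_⟩
  · have h2 : p.2 = q.2 := by
      by_contra hne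
      exact h (by rw [kronecker_apply, one_apply_ne hne, mul_zero])
    exact congrFun h2 i
  · simp [Qubit.sys, one_apply]

/-- An operator that acts trivially on each of the unloaded qubits is `g ⊗ I`. -/
theorem exists_eq_kronecker_one {m n : ℕ} {r : Finset (Fin n)} (G : L (Sys m r))
    (hG : ∀ i : r, Intertwines (Qubit.sys m i) (Qubit.sys m i) G) :
    ∃ g : L (Bits (Fin m)), G = g ⊗ₖ (1 : L (Bits r)) := by
  refine ⟨Matrix.of fun x x' => G (x, fun _ => false) (x', fun _ => false), ?_⟩
  -- flip the bits of `y` to `false` one by one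
  have key : ∀ (s : Finset r) (y : Bits r) (x x' : Bits (Fin m)), (∀ i, y i = true ↔ i ∈ s) →
      G (x, y) (x', y) = G (x, fun _ => false) (x', fun _ => false) := by
    intro s
    induction s using Finset.induction_on with
    | empty =>
      intro y x x' h
      have : y = fun _ => false := funext fun i => by simpa using h i
      rw [this]
    | insert a s ha ih =>
      intro y x x' h
      rw [← ih ((Qubit.bits a).flip y) x x']
      · exact ((hG a).2 (x, y) (x', y)).symm
      · intro i
        by_cases hi : i = a
        · subst hi
          have h1 : y i = true := (h i).2 (Finset.mem_insert_self _ _)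
          simp [Qubit.bits_flip_apply, h1, ha]
        · have h1 := h i
          simp only [Finset.mem_insert, hi, false_or] at h1
          simpa [Qubit.bits_flip_apply, hi] using h1
  ext ⟨x, y⟩ ⟨x', y'⟩
  rw [kronecker_apply]
  by_cases hy : y = y'
  · subst hy
    simp only [one_apply_eq, mul_one, of_apply]
    exact key (Finset.univ.filter fun i => y i = true) y x x' (by simp)
  · rw [one_apply_ne hy, mul_zero]
    by_contra hne
    exact hy (funext fun i => (hG i).1 _ _ hne)

theorem ptraceRight_relabel_single {h a b : Type} [DecidableEq h] [DecidableEq a] [Fintype b]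
    [DecidableEq b] (s : h ≃ a × b) (i j : h) :
    ptraceRight (relabel s (single j i (1 : ℂ))) =
      if (s i).2 = (s j).2 then single (s j).1 (s i).1 1 else 0 := by
  have h1 : ∀ (z : h) (u : a) (x : b), z = s.symm (u, x) ↔ x = (s z).2 ∧ (s z).1 = u := by
    intro z u x
    rw [Equiv.eq_symm_apply, Prod.ext_iff, and_comm, eq_comm (a := x)]
  ext u v
  change ∑ x : b, single j i (1 : ℂ) (s.symm (u, x)) (s.symm (v, x)) = _
  simp only [single_apply, h1]
  rw [Finset.sum_eq_single (s j).2 (fun x _ hx => if_neg fun h => hx h.1.1) (by simp)]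
  by_cases hij : (s i).2 = (s j).2
  · simp [hij, single_apply]
  · simp [hij, Ne.symm hij, eq_comm]

/-- A POVM element whose probabilities depend only on the marginal state of the other qubits acts
trivially on `q`; this is read off by testing it on matrix units. -/
theorem NoSignalingFromQubit.intertwines {n : ℕ} {κ : Type} [Fintype κ] {q : Fin n}
    {E : κ → L (Bits (Fin n))} (h : NoSignalingFromQubit q E) (k : κ) :
    Intertwines (Qubit.bits q) (Qubit.bits q) (E k) := by
  obtain ⟨F, -, hF⟩ := h
  have hE : ∀ i j, E k i j = if (splitQubit q i).2 = (splitQubit q j).2 then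
      F k (splitQubit q i).1 (splitQubit q j).1 else 0 := fun i j => by
    have h1 := hF k (single j i 1)
    rw [trace_mul_single, MulOpposite.op_one, one_smul, ptraceRight_relabel_single] at h1
    rw [h1]
    split_ifs <;> simp [trace_mul_single]
  refine ⟨fun i j hne => ?_, fun i j => ?_⟩
  · by_contra hij
    exact hne (by rw [hE]; exact if_neg fun h => hij (congrFun h ⟨q, by simp⟩))
  · have h1 : ∀ z : Bits (Fin n),
        (splitQubit q ((Qubit.bits q).flip z)).1 = (splitQubit q z).1 := fun z => by
      ext ⟨s, hs⟩
      simp [splitQubit, Qubit.bits_flip_apply, hs]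
    have h2 : ∀ z : Bits (Fin n), (splitQubit q ((Qubit.bits q).flip z)).2 =
        fun s => !(splitQubit q z).2 s := fun z => by
      ext ⟨s, hs⟩
      obtain rfl : s = q := not_not.1 hs
      simp [splitQubit, Qubit.bits_flip_apply]
    rw [hE, hE, h1, h1, h2, h2]
    simp [funext_iff]

/-! ### Circuits with one Kraus operator per classical value -/

theorem conjMap_apply {a b : Type} [Fintype b] (A : Matrix a b ℂ) (ρ : L b) :
    conjMap A ρ = A * ρ * Aᴴ := rfl

theorem conjMap_comp {a b c : Type} [Fintype b] [Fintype c] (A : Matrix a b ℂ)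
    (B : Matrix b c ℂ) : conjMap A ∘ₗ conjMap B = conjMap (A * B) := by
  ext1 ρ
  simp only [LinearMap.comp_apply, conjMap_apply, conjTranspose_mul, Matrix.mul_assoc]

theorem conjMap_zero {a b : Type} [Fintype b] : conjMap (0 : Matrix a b ℂ) = 0 := by
  ext1 ρ
  simp [conjMap_apply]

/-- Some circuit maps the input `ρ` to the state `W k * ρ * (W k)†` with classical value `k`. -/
def Realises {m n : ℕ} {κ : Type} {r : Finset (Fin n)}
    (W : κ → Matrix (Sys m r) (Bits (Fin n)) ℂ) : Prop :=
  ∃ C : Circuit m n κ r, ∀ k, C.run k = conjMap (W k)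

namespace Realises

variable {m n : ℕ} {κ κ' : Type} [Fintype κ] {r r' : Finset (Fin n)}
  {W : κ → Matrix (Sys m r) (Bits (Fin n)) ℂ}

theorem unitary (h : Realises W) (U : κ → Matrix.unitaryGroup (Bits (Fin m)) ℂ) :
    Realises fun k => ((U k : L (Bits (Fin m))) ⊗ₖ (1 : L (Bits r))) * W k := by
  obtain ⟨C, hC⟩ := h
  refine ⟨C.snoc (.unitary U), fun k => ?_⟩
  rw [Circuit.run, Finset.sum_eq_single k, ElemOp.instr, if_pos rfl, hC, conjMap_comp]
  · intro k' _ hk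
    rw [ElemOp.instr, if_neg (Ne.symm hk), LinearMap.zero_comp]
  · simp

theorem measure (h : Realises W) (S : κ → Finset (Fin m)) :
    Realises fun k : (Σ k : κ, Bits (S k)) =>
      (measOp (S k.1) k.2 ⊗ₖ (1 : L (Bits r))) * W k.1 := by
  obtain ⟨C, hC⟩ := h
  refine ⟨C.snoc (.measure S), fun k => ?_⟩
  rw [Circuit.run, Finset.sum_eq_single k.1, ElemOp.instr, Finset.sum_eq_single k.2, if_pos rfl,
    hC, conjMap_comp]
  · intro x _ hx
    refine if_neg fun h => hx ?_
    obtain ⟨k, y⟩ := k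
    cases h
    rfl
  · simp
  · intro k' _ hk
    rw [ElemOp.instr, Finset.sum_eq_zero, LinearMap.zero_comp]
    intro x _
    refine if_neg fun h => hk ?_
    rw [h]
  · simp

theorem load (h : Realises W) {J : Finset (Fin n)} (hJ : J ⊆ r) (hr' : r' = r \ J)
    (σ : κ → (J ↪ Fin m)) :
    Realises fun k : κ × Bits J => loadOp hJ hr' (σ k.1) k.2 * W k.1 := by
  obtain ⟨C, hC⟩ := h
  refine ⟨C.snoc (.load J hJ hr' σ), fun k => ?_⟩
  rw [Circuit.run, Finset.sum_eq_single k.1, ElemOp.instr, Finset.sum_eq_single k.2, if_pos rfl,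
    hC, conjMap_comp]
  · intro x _ hx
    refine if_neg fun h => hx ?_
    obtain ⟨k, y⟩ := k
    cases h
    rfl
  · simp
  · intro k' _ hk
    rw [ElemOp.instr, Finset.sum_eq_zero, LinearMap.zero_comp]
    intro x _
    refine if_neg fun h => hk ?_
    rw [h]
  · simp

/-- Classical processing by `f` keeps one Kraus operator per value if at most one of the values that
`f` identifies, the one chosen by the section `g`, occurs with nonzero probability. -/
theorem classical [Fintype κ'] (h : Realises W) (f : κ → κ') (g : κ' → κ)
    (hg : ∀ k', f (g k') = k') (hW : ∀ k, k ≠ g (f k) → W k = 0) :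
    Realises fun k' => W (g k') := by
  obtain ⟨C, hC⟩ := h
  refine ⟨C.snoc (.classical f), fun k' => ?_⟩
  rw [Circuit.run, Finset.sum_eq_single (g k'), ElemOp.instr, if_pos (hg k').symm, hC,
    LinearMap.id_comp]
  · intro k _ hk
    rw [ElemOp.instr]
    split_ifs with hf
    · rw [hC, hW k (by rwa [← hf]), conjMap_zero, LinearMap.comp_zero]
    · rw [LinearMap.zero_comp]
  · simp

end Realises

/-- The isometry `|0⟩^{⊗ m} ⊗ I` that prepares the initial state. -/
def initOp (m n : ℕ) : Matrix (Sys m (Finset.univ : Finset (Fin n))) (Bits (Fin n)) ℂ :=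
  Matrix.of fun p z => if p = (⟨fun _ => false, fun i => z i⟩ : Sys m Finset.univ) then 1 else 0

theorem realises_initOp (m n : ℕ) : Realises fun _ : Unit => initOp m n := by
  refine ⟨.nil, fun _ => ?_⟩
  ext ρ p q
  have h : ∀ (p : Sys m (Finset.univ : Finset (Fin n))) z,
      p = (⟨fun _ => false, fun i => z i⟩ : Sys m Finset.univ) ↔
        z = (fun i => p.2 ⟨i, Finset.mem_univ i⟩) ∧ p.1 = fun _ => false := by
    rintro ⟨x, y⟩ z
    rw [Prod.mk.injEq, and_comm, and_congr_left_iff]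
    rintro -
    constructor
    · rintro rfl; rfl
    · rintro rfl; rfl
  have hl : ∀ ρ : L (Bits (Fin n)), ∀ p z, (initOp m n * ρ) p z =
      if p.1 = (fun _ => false) then ρ (fun i => p.2 ⟨i, Finset.mem_univ i⟩) z else 0 := by
    intro ρ p z
    rw [Matrix.mul_apply]
    simp only [initOp, of_apply, h]
    rw [Finset.sum_eq_single (fun i => p.2 ⟨i, Finset.mem_univ i⟩)]
    · split_ifs <;> simp_all
    · intro b _ hb
      rw [if_neg (fun h => hb h.1), zero_mul]
    · simp
  have hr : (initOp m n * ρ * (initOp m n)ᴴ) p q =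
      if q.1 = (fun _ => false) then (initOp m n * ρ) p (fun i => q.2 ⟨i, Finset.mem_univ i⟩)
      else 0 := by
    rw [Matrix.mul_apply]
    simp only [conjTranspose_apply]
    rw [Finset.sum_eq_single (fun i => q.2 ⟨i, Finset.mem_univ i⟩)]
    · simp only [initOp, of_apply, h]
      split_ifs <;> simp_all
    · intro b _ hb
      simp only [initOp, of_apply, h]
      rw [if_neg (fun h => hb h.1), star_zero, mul_zero]
    · simp
  rw [conjMap_apply, hr, hl]
  change (single (fun _ => false) (fun _ => false) (1 : ℂ) : L (Bits (Fin m))) p.1 q.1 *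
    ρ (fun i => p.2 ⟨i, Finset.mem_univ i⟩) (fun i => q.2 ⟨i, Finset.mem_univ i⟩) = _
  rw [single_apply]
  simp only [eq_comm (a := fun _ : Fin m => false)]
  split_ifs <;> simp_all

/-! ### Loading a set of qubits -/

section Load

variable {m n : ℕ} {r r' J : Finset (Fin n)}

/-- The label that `⟨x|_S ⊗ I` with subsequent loading takes to `p`: the slots in the range of `σ`
carry `x`, and their values in `p` are those of the qubits in `J`. -/
noncomputable def unload (hr' : r' = r \ J) (σ : J ↪ Fin m) (x : Bits J) (p : Sys m r') : Sys m r :=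
  ((fun s => if h : ∃ j, σ j = s then x h.choose else p.1 s),
    fun i => if h : (i : Fin n) ∈ J then p.1 (σ ⟨i, h⟩) else
      p.2 ⟨i, by rw [hr']; exact Finset.mem_sdiff.2 ⟨i.2, h⟩⟩)

theorem unload_fst_apply (hr' : r' = r \ J) (σ : J ↪ Fin m) (x : Bits J) (p : Sys m r') (j : J) :
    (unload hr' σ x p).1 (σ j) = x j := by
  have h : ∃ j', σ j' = σ j := ⟨j, rfl⟩
  have h2 : h.choose = j := σ.injective h.choose_spec
  simp only [unload]
  rw [dif_pos h, h2]

theorem loadOp_apply (hJ : J ⊆ r) (hr' : r' = r \ J) (σ : J ↪ Fin m) (x : Bits J) (p : Sys m r')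
    (q : Sys m r) :
    loadOp hJ hr' σ x p q = if q = unload hr' σ x p then 1 else 0 := by
  rw [loadOp, of_apply]
  congr 1
  rw [eq_iff_iff]
  constructor
  · rintro ⟨h1, h2, h3, h4⟩
    refine Prod.ext (funext fun s => ?_) (funext fun i => ?_)
    · by_cases hs : ∃ j, σ j = s
      · obtain ⟨j, rfl⟩ := hs
        rw [unload_fst_apply, h1]
      · simp only [unload]
        rw [dif_neg hs, h2 s hs]
    · simp only [unload]
      split_ifs with h
      · exact (h3 ⟨i, h⟩).symm
      · exact (h4 ⟨i, by rw [hr']; exact Finset.mem_sdiff.2 ⟨i.2, h⟩⟩).symm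
  · rintro rfl
    refine ⟨unload_fst_apply hr' σ x p, fun s hs => ?_, fun j => ?_, fun i => ?_⟩
    · simp only [unload]
      have hs' : ¬∃ j, σ j = s := hs
      rw [dif_neg hs']
    · simp only [unload]
      rw [dif_pos j.2]
    · have h : (i : Fin n) ∉ J := (Finset.mem_sdiff.1 (hr'.subset i.2)).2
      simp only [unload]
      rw [dif_neg h]

theorem unload_injective (hJ : J ⊆ r) (hr' : r' = r \ J) (σ : J ↪ Fin m) (x : Bits J) :
    Function.Injective (unload hr' (r := r) σ x) := by
  intro p q h
  have h1 := congrFun (congrArg Prod.fst h)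
  have h2 := congrFun (congrArg Prod.snd h)
  refine Prod.ext (funext fun s => ?_) (funext fun i => ?_)
  · by_cases hs : ∃ j, σ j = s
    · obtain ⟨j, rfl⟩ := hs
      have := h2 ⟨j, hJ j.2⟩
      simp only [unload] at this
      rwa [dif_pos j.2, dif_pos j.2] at this
    · have := h1 s
      simp only [unload] at this
      rwa [dif_neg hs, dif_neg hs] at this
  · have hi := Finset.mem_sdiff.1 (hr'.subset i.2)
    have := h2 ⟨i, hi.1⟩
    simp only [unload] at this
    rwa [dif_neg hi.2, dif_neg hi.2] at this

theorem exists_unload_eq_iff (hJ : J ⊆ r) (hr' : r' = r \ J) (σ : J ↪ Fin m) (x : Bits J)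
    (q : Sys m r) :
    (∃ p, unload hr' σ x p = q) ↔ ∀ j, q.1 (σ j) = x j := by
  constructor
  · rintro ⟨p, rfl⟩ j
    exact unload_fst_apply hr' σ x p j
  · intro h
    refine ⟨⟨fun s => if h : ∃ j, σ j = s then q.2 ⟨h.choose, hJ h.choose.2⟩ else q.1 s,
      fun i => q.2 ⟨i, (Finset.mem_sdiff.1 (hr'.subset i.2)).1⟩⟩, ?_⟩
    refine Prod.ext (funext fun s => ?_) (funext fun i => ?_)
    · by_cases hs : ∃ j, σ j = s
      · obtain ⟨j, rfl⟩ := hs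
        rw [unload_fst_apply, h]
      · simp only [unload]
        rw [dif_neg hs, dif_neg hs]
    · simp only [unload]
      split_ifs with h1 h2
      · have h3 : h2.choose = ⟨i, h1⟩ := σ.injective h2.choose_spec
        simp only [h3]
      · exact absurd ⟨_, rfl⟩ h2
      · rfl

theorem loadOp_mul_conjTranspose (hJ : J ⊆ r) (hr' : r' = r \ J) (σ : J ↪ Fin m) (x : Bits J) :
    loadOp hJ hr' σ x * (loadOp hJ hr' σ x)ᴴ = 1 := by
  ext p q
  rw [Matrix.mul_apply]
  simp only [conjTranspose_apply, loadOp_apply, one_apply]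
  rw [Finset.sum_eq_single (unload hr' σ x p) (fun b _ hb => by rw [if_neg hb, zero_mul])
    (by simp)]
  rw [if_pos rfl, one_mul, if_congr (unload_injective hJ hr' σ x).eq_iff rfl rfl]
  split_ifs <;> simp

/-- The effect of the outcome `x` of the measurement that precedes the loading. -/
theorem conjTranspose_mul_loadOp (hJ : J ⊆ r) (hr' : r' = r \ J) (σ : J ↪ Fin m) (x : Bits J) :
    (loadOp hJ hr' σ x)ᴴ * loadOp hJ hr' σ x =
      diagonal (fun y : Bits (Fin m) => if ∀ j, y (σ j) = x j then (1 : ℂ) else 0) ⊗ₖ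
        (1 : L (Bits r)) := by
  rw [← diagonal_one, diagonal_kronecker_diagonal]
  ext p q
  rw [Matrix.mul_apply, diagonal_apply]
  simp only [conjTranspose_apply, loadOp_apply, mul_one]
  rw [if_congr Iff.rfl (if_congr (exists_unload_eq_iff hJ hr' σ x p).symm rfl rfl) rfl]
  by_cases h : ∃ p', unload hr' σ x p' = p
  · obtain ⟨p', rfl⟩ := h
    rw [Finset.sum_eq_single p', if_pos rfl,
      if_pos (⟨p', rfl⟩ : ∃ p, unload hr' σ x p = unload hr' σ x p'), star_one, one_mul]
    · simp only [eq_comm]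
    · intro b _ hb
      rw [if_neg (fun h => hb ((unload_injective hJ hr' σ x) h).symm), star_zero, zero_mul]
    · simp
  · rw [if_neg h, ite_self, Finset.sum_eq_zero]
    intro b _
    rw [if_neg (fun h' => h ⟨b, h'.symm⟩), star_zero, zero_mul]

theorem intertwines_loadOp (hJ : J ⊆ r) (hr' : r' = r \ J) (σ : J ↪ Fin m) (x : Bits J)
    (i : Fin n) (hi : i ∈ r) (hi' : i ∈ r') :
    Intertwines (Qubit.sys m ⟨i, hi'⟩) (Qubit.sys m ⟨i, hi⟩) (loadOp hJ hr' σ x) := by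
  have hiJ : i ∉ J := (Finset.mem_sdiff.1 (hr'.subset hi')).2
  have hval : ∀ p, (unload hr' σ x p).2 ⟨i, hi⟩ = p.2 ⟨i, hi'⟩ := fun p => by
    simp only [unload]
    rw [dif_neg hiJ]
  have hflip : ∀ p, unload hr' σ x ((Qubit.sys m ⟨i, hi'⟩).flip p) =
      (Qubit.sys m ⟨i, hi⟩).flip (unload hr' σ x p) := fun p => by
    refine Prod.ext rfl (funext fun s => ?_)
    change (unload hr' σ x ((Qubit.sys m ⟨i, hi'⟩).flip p)).2 s =
      Function.update (unload hr' σ x p).2 ⟨i, hi⟩ (!(unload hr' σ x p).2 ⟨i, hi⟩) s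
    rw [hval]
    by_cases hs : s = ⟨i, hi⟩
    · rw [hs, Function.update_self, hval]
      change Function.update p.2 ⟨i, hi'⟩ _ ⟨i, hi'⟩ = _
      rw [Function.update_self]
    · rw [Function.update_of_ne hs]
      simp only [unload]
      split_ifs with h
      · rfl
      · change Function.update p.2 ⟨i, hi'⟩ _ _ = _
        rw [Function.update_of_ne]
        intro h'
        exact hs (Subtype.ext (Subtype.ext_iff.1 h' :))
  refine ⟨fun p q h => ?_, fun p q => ?_⟩
  · rw [loadOp_apply, ne_eq, ite_eq_right_iff, not_forall] at h
    obtain ⟨rfl, -⟩ := h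
    exact (hval p).symm
  · rw [loadOp_apply, loadOp_apply, hflip]
    simp only [EmbeddingLike.apply_eq_iff_eq]

end Load

/-! ### Storing the post-measurement state in fewer qubits -/

theorem kronecker_one_left_injective {a b : Type} [DecidableEq b] [Nonempty b] {M N : L a}
    (h : M ⊗ₖ (1 : L b) = N ⊗ₖ (1 : L b)) : M = N := by
  obtain ⟨y⟩ := ‹Nonempty b›
  ext i j
  simpa using congrFun (congrFun h (i, y)) (j, y)

/-- Some circuit performs the projective measurement `F` and maps the range of the observed element
`F k` unitarily onto the space of the `m` available qubits and the unloaded qubits `r`, acting as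
the identity on the latter. -/
def Compresses (m : ℕ) {n : ℕ} {κ : Type} (r : Finset (Fin n)) (F : κ → L (Bits (Fin n))) : Prop :=
  ∃ W : κ → Matrix (Sys m r) (Bits (Fin n)) ℂ, Realises W ∧ (∀ k, W k * (W k)ᴴ = 1) ∧
    (∀ k, (W k)ᴴ * W k = F k) ∧
    ∀ (k : κ) (i : r), Intertwines (Qubit.sys m i) (Qubit.bits i.1) (W k)

theorem conjTranspose_mul_initOp (m n : ℕ) : (initOp m n)ᴴ * initOp m n = 1 := by
  ext z z'
  rw [Matrix.mul_apply, one_apply]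
  simp only [conjTranspose_apply, initOp, of_apply]
  rw [Finset.sum_eq_single (⟨fun _ => false, fun i => z i⟩ : Sys m Finset.univ)]
  · rw [if_pos rfl, star_one, one_mul]
    refine if_congr ⟨fun h => funext fun i => ?_, fun h => by rw [h]⟩ rfl rfl
    exact congrFun (congrArg Prod.snd h) ⟨i, Finset.mem_univ i⟩
  · intro p _ hp
    rw [if_neg hp, star_zero, zero_mul]
  · simp

theorem initOp_mul_conjTranspose (m n : ℕ) :
    initOp m n * (initOp m n)ᴴ =
      diagonal (fun y : Bits (Fin m) => if y = (fun _ => false) then (1 : ℂ) else 0) ⊗ₖ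
        (1 : L (Bits (Finset.univ : Finset (Fin n)))) := by
  rw [← diagonal_one, diagonal_kronecker_diagonal]
  ext p q
  rw [Matrix.mul_apply, diagonal_apply, Finset.sum_eq_single fun i => p.2 ⟨i, Finset.mem_univ i⟩]
  · simp only [conjTranspose_apply, initOp, of_apply, Prod.ext_iff, and_true, mul_one]
    by_cases h1 : p.1 = fun _ => false
    · simp [h1, eq_comm]
    · simp [h1]
  · intro z _ hz
    simp only [initOp, of_apply]
    rw [if_neg, zero_mul]
    intro h
    exact hz (by rw [h])
  · simp

theorem diagonal_kronecker_mul_initOp {m n : ℕ} (d : Bits (Fin m) → ℂ) :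
    (diagonal d ⊗ₖ (1 : L (Bits (Finset.univ : Finset (Fin n))))) * initOp m n =
      d (fun _ => false) • initOp m n := by
  rw [← diagonal_one, diagonal_kronecker_diagonal]
  ext p z
  rw [diagonal_mul, Matrix.smul_apply, initOp, of_apply]
  split_ifs with h
  · simp [h]
  · simp

theorem intertwines_initOp (m n : ℕ) (i : Fin n) :
    Intertwines (Qubit.sys m ⟨i, Finset.mem_univ i⟩) (Qubit.bits i) (initOp m n) := by
  refine ⟨fun p z h => ?_, fun p z => ?_⟩
  · simp only [initOp, of_apply, ne_eq, ite_eq_right_iff, not_forall] at h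
    obtain ⟨rfl, -⟩ := h
    rfl
  · simp only [initOp, of_apply]
    have h : (⟨fun _ => false, fun j => (Qubit.bits i).flip z j⟩ : Sys m Finset.univ) =
        (Qubit.sys m ⟨i, Finset.mem_univ i⟩).flip ⟨fun _ => false, fun j => z j⟩ := by
      refine Prod.ext rfl (funext fun j => ?_)
      change Function.update z i (!z i) j.1 =
        Function.update (fun j : (Finset.univ : Finset (Fin n)) => z j) ⟨i, _⟩ (!z i) j
      simp [Function.update_apply, Subtype.ext_iff]
    rw [h]
    simp only [EmbeddingLike.apply_eq_iff_eq]

/-- Loading all but the qubits in `r` at once fills the available qubits, and loses nothing, because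
the discarded qubits are in a known state. -/
theorem compresses_one {m n : ℕ} (r : Finset (Fin n)) (hr : (Finset.univ \ r).card = m) :
    Compresses m r (fun _ : Unit => (1 : L (Bits (Fin n)))) := by
  let σ : ↥(Finset.univ \ r) ≃ Fin m := Finset.equivFinOfCardEq hr
  have hJ : Finset.univ \ r ⊆ Finset.univ := Finset.subset_univ _
  have hr' : r = Finset.univ \ (Finset.univ \ r) := by simp
  let N := fun x => loadOp hJ hr' σ.toEmbedding x
  let x₀ : Bits ↥(Finset.univ \ r) := fun _ => false
  have hN : ∀ x, (N x)ᴴ * N x * initOp m n = if x = x₀ then initOp m n else 0 := fun x => by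
    rw [conjTranspose_mul_loadOp, diagonal_kronecker_mul_initOp]
    have : (∀ j, false = x j) ↔ x = x₀ := by
      rw [funext_iff]; exact forall_congr' fun j => eq_comm
    simp only [this, ite_smul, one_smul, zero_smul]
  have h0 : ∀ x, x ≠ x₀ → N x * initOp m n = 0 := fun x hx => by
    rw [← conjTranspose_mul_self_eq_zero, conjTranspose_mul, Matrix.mul_assoc,
      ← Matrix.mul_assoc (N x)ᴴ, hN, if_neg hx, Matrix.mul_zero]
  refine ⟨fun _ => N x₀ * initOp m n, ?_, fun _ => ?_, fun _ => ?_, fun _ i => ?_⟩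
  · exact ((realises_initOp m n).load hJ hr' fun _ => σ.toEmbedding).classical
      (fun _ => ()) (fun _ => ((), x₀)) (fun _ => rfl)
      fun k hk => h0 k.2 fun h => hk (Prod.ext rfl h)
  -- all the slots are measured, so the outcome `0` projects onto the initial state
  · have hD : initOp m n * (initOp m n)ᴴ = (N x₀)ᴴ * N x₀ := by
      rw [initOp_mul_conjTranspose, conjTranspose_mul_loadOp]
      congr 3
      funext y
      refine if_congr ?_ rfl rfl
      rw [funext_iff]
      exact σ.surjective.forall
    calc N x₀ * initOp m n * (N x₀ * initOp m n)ᴴ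
        = N x₀ * (initOp m n * (initOp m n)ᴴ) * (N x₀)ᴴ := by
          simp only [conjTranspose_mul, Matrix.mul_assoc]
      _ = (N x₀ * (N x₀)ᴴ) * (N x₀ * (N x₀)ᴴ) := by
          rw [hD]; simp only [Matrix.mul_assoc]
      _ = 1 := by rw [loadOp_mul_conjTranspose, Matrix.one_mul]
  · rw [conjTranspose_mul, Matrix.mul_assoc, ← Matrix.mul_assoc (N x₀)ᴴ, hN, if_pos rfl,
      conjTranspose_mul_initOp]
  · exact (intertwines_loadOp hJ hr' _ _ i.1 (Finset.mem_univ _) i.2).mul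
      (intertwines_initOp m n i.1)

theorem IsProjectiveMeasurement.sum_mul {a κ κ' : Type} [Fintype a] [DecidableEq a]
    [Fintype κ'] [DecidableEq κ] {F' : κ' → L a} (hF' : IsProjectiveMeasurement F')
    (f : κ' → κ) (l : κ') : (∑ l' with f l' = f l, F' l') * F' l = F' l := by
  rw [Finset.sum_mul, Finset.sum_eq_single l, (hF'.2 l).1]
  · intro l' _ hl
    exact hF'.mul_eq_zero hl
  · simp

/-- If every fiber of `f` has as many elements as `x`, then `κ'` is `κ × x`. -/
theorem exists_equiv_of_card_fiber {κ κ' x : Type} [Fintype κ'] [Fintype x] [DecidableEq κ]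
    (f : κ' → κ) (h : ∀ k, (Finset.univ.filter fun l => f l = k).card = Fintype.card x) :
    ∃ e : κ × x ≃ κ', ∀ p, f (e p) = p.1 := by
  have h' : ∀ k, Fintype.card x = Fintype.card {l // f l = k} := fun k => by
    rw [← h, Fintype.card_subtype]
  let τ := fun k => Fintype.equivOfCardEq (h' k)
  exact ⟨((Equiv.sigmaEquivProd κ x).symm.trans (Equiv.sigmaCongrRight τ)).trans
    (Equiv.sigmaFiberEquiv f), fun p => (τ p.1 p.2).2⟩

theorem mul_conjTranspose_eq_zero_of_projections {a o : Type} [Fintype a] [Fintype o]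
    [DecidableEq o] {V V' : Matrix o a ℂ} (hV : V * Vᴴ = 1) (hV' : V' * V'ᴴ = 1)
    (h : (Vᴴ * V) * (V'ᴴ * V') = 0) : V * V'ᴴ = 0 := by
  calc V * V'ᴴ = (V * Vᴴ) * (V * V'ᴴ) * (V' * V'ᴴ) := by
        rw [hV, hV', Matrix.one_mul, Matrix.mul_one]
    _ = V * ((Vᴴ * V) * (V'ᴴ * V')) * V'ᴴ := by simp only [Matrix.mul_assoc]
    _ = 0 := by rw [h, Matrix.mul_zero, Matrix.zero_mul]

theorem trace_one_sys (m : ℕ) {n : ℕ} (r : Finset (Fin n)) :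
    (1 : L (Sys m r)).trace = 2 ^ m * (2 : ℂ) ^ r.card := by
  rw [trace_one]
  simp

theorem Compresses.trace_eq {m n : ℕ} {κ : Type} {r : Finset (Fin n)}
    {F : κ → L (Bits (Fin n))} (h : Compresses m r F) (k : κ) :
    (F k).trace = 2 ^ m * (2 : ℂ) ^ r.card := by
  obtain ⟨W, -, hW, hWF, -⟩ := h
  rw [← hWF, trace_mul_comm, hW, trace_one_sys]

/-- One round of the protocol. Conditioned on `k`, the refined measurement `F'` becomes a
measurement of the available qubits with two outcomes of equal rank. A unitary turns it into
the computational basis measurement of one slot, which the unloaded qubit `a` can then occupy. -/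
theorem Compresses.refine {m n : ℕ} {κ κ' : Type} [Fintype κ] [Fintype κ'] [DecidableEq κ]
    {r r' : Finset (Fin n)} {F : κ → L (Bits (Fin n))} {F' : κ' → L (Bits (Fin n))}
    (h : Compresses m r F) {a : Fin n} (ha : a ∈ r) (hr' : r' = r \ {a})
    (hF' : IsProjectiveMeasurement F') (f : κ' → κ) (hf : ∀ k, F k = ∑ l with f l = k, F' l)
    (htr : ∀ k l, 2 * (F' l).trace = (F k).trace)
    (hloc : ∀ l, ∀ i ∈ r, Intertwines (Qubit.bits i) (Qubit.bits i) (F' l)) :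
    Compresses m r' F' := by
  have htrF := h.trace_eq
  obtain ⟨W, hWr, hW, hWF, hWi⟩ := h
  have hFF' : ∀ l, F (f l) * F' l = F' l := fun l => by rw [hf]; exact hF'.sum_mul f l
  have hF'F : ∀ l, F' l * F (f l) = F' l := fun l => by
    have := congrArg Matrix.conjTranspose (hFF' l)
    rwa [conjTranspose_mul, (hF'.2 l).2, ← hWF, conjTranspose_mul, conjTranspose_conjTranspose,
      hWF] at this
  -- the elements of `F'` on the compressed space
  have hg : ∀ l, ∃ g : L (Bits (Fin m)), W (f l) * F' l * (W (f l))ᴴ = g ⊗ₖ (1 : L (Bits r)) :=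
    fun l => exists_eq_kronecker_one _ fun i =>
      ((hWi (f l) i).mul (hloc l i i.2)).mul (hWi (f l) i).conjTranspose
  choose g hg using hg
  have hGG : ∀ l l', f l = f l' → (g l * g l') ⊗ₖ (1 : L (Bits r)) =
      W (f l) * (F' l * F' l') * (W (f l))ᴴ := fun l l' hl => by
    calc (g l * g l') ⊗ₖ (1 : L (Bits r))
        = (g l ⊗ₖ (1 : L (Bits r))) * (g l' ⊗ₖ (1 : L (Bits r))) := by
          rw [← mul_kronecker_mul, Matrix.one_mul]
      _ = W (f l) * (F' l * ((W (f l))ᴴ * W (f l)) * F' l') * (W (f l))ᴴ := by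
          rw [← hg, ← hg, ← hl]; simp only [Matrix.mul_assoc]
      _ = _ := by rw [hWF, hF'F]
  have hgg : ∀ l, g l * g l = g l := fun l => kronecker_one_left_injective (b := Bits r) (by
    rw [hGG l l rfl, (hF'.2 l).1, hg])
  have hgg' : ∀ l l', f l = f l' → l ≠ l' → g l * g l' = 0 := fun l l' hl hne =>
    kronecker_one_left_injective (b := Bits r) (by
      rw [hGG l l' hl, hF'.mul_eq_zero hne, Matrix.mul_zero, Matrix.zero_mul, zero_kronecker])
  have hgh : ∀ l, (g l).IsHermitian := fun l => kronecker_one_left_injective (b := Bits r) (by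
    have : (g l ⊗ₖ (1 : L (Bits r)))ᴴ = g l ⊗ₖ (1 : L (Bits r)) := by
      rw [← hg, conjTranspose_mul, conjTranspose_mul, conjTranspose_conjTranspose, (hF'.2 l).2,
        Matrix.mul_assoc]
    rwa [conjTranspose_kronecker, conjTranspose_one] at this)
  have hgt : ∀ l, 2 * (g l).trace = 2 ^ m := fun l => by
    have h1 : (g l).trace * 2 ^ r.card = (F' l).trace := by
      have h2 : (g l ⊗ₖ (1 : L (Bits r))).trace = (g l).trace * 2 ^ r.card := by
        rw [trace_kronecker, trace_one]; simp
      rw [← h2, ← hg, trace_mul_comm, ← Matrix.mul_assoc, hWF, hFF']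
    have h3 := htr (f l) l
    rw [htrF, ← h1, ← mul_assoc] at h3
    exact mul_right_cancel₀ (pow_ne_zero _ two_ne_zero) h3
  -- there is an available qubit, since the trace of a projector is an integer
  have hκ' : Nonempty κ' := by
    by_contra hne
    rw [not_nonempty_iff] at hne
    have := hF'.1.2
    rw [Finset.univ_eq_empty, Finset.sum_empty] at this
    exact zero_ne_one this
  have hm : m ≠ 0 := by
    rintro rfl
    obtain ⟨l⟩ := hκ'
    have := hgt l
    rw [trace_eq_rank (hgh l) (hgg l)] at this
    have h2 : 2 * (g l).rank = 1 := by exact_mod_cast this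
    omega
  let s₀ : Fin m := ⟨0, Nat.pos_of_ne_zero hm⟩
  let e : Bits (Fin m) ≃ Bits ({a} : Finset (Fin n)) × Bits {s : Fin m // s ≠ s₀} :=
    (Equiv.funSplitAt s₀ Bool).trans
      (Equiv.prodCongr (Equiv.funUnique ({a} : Finset (Fin n)) Bool).symm (Equiv.refl _))
  have he : ∀ y (x : Bits ({a} : Finset (Fin n))), (e y).1 = x ↔ ∀ j, y s₀ = x j :=
    fun y x => funext_iff
  have hcard : ∀ l, (g l).trace = Fintype.card (Bits {s : Fin m // s ≠ s₀}) := fun l => by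
    have h1 : 2 * Fintype.card (Bits {s : Fin m // s ≠ s₀}) = 2 ^ m := by
      have := Fintype.card_congr e
      simp only [Fintype.card_prod, Fintype.card_fun, Fintype.card_bool, Fintype.card_fin] at this
      rw [this]
      simp
    have h2 : (2 : ℂ) * Fintype.card (Bits {s : Fin m // s ≠ s₀}) = 2 ^ m := by exact_mod_cast h1
    exact mul_left_cancel₀ two_ne_zero ((hgt l).trans h2.symm)
  -- by the traces, each outcome `k` has exactly two refinements, labelled by the outcome of one slot
  obtain ⟨E, hE⟩ := exists_equiv_of_card_fiber (x := Bits ({a} : Finset (Fin n))) f fun k => by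
    have h1 : 2 * (F k).trace = (Finset.univ.filter fun l => f l = k).card * (F k).trace := by
      conv_lhs => rw [hf, trace_sum, Finset.mul_sum, Finset.sum_congr rfl fun l _ => htr k l]
      rw [Finset.sum_const, nsmul_eq_mul]
    have h2 : (F k).trace ≠ 0 := by
      rw [htrF]
      exact mul_ne_zero (pow_ne_zero _ two_ne_zero) (pow_ne_zero _ two_ne_zero)
    have h3 : 2 = (Finset.univ.filter fun l => f l = k).card := by
      exact_mod_cast mul_right_cancel₀ h2 h1
    rw [← h3]
    simp
  -- the blocks of the unitary `Q k` are coisometries with support projectors `g l`, `f l = k`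
  choose V hV hV' using fun l => exists_coisometry (hgh l) (hgg l) (hcard l)
  choose Q _ hQ using fun k => exists_unitary_of_coisometries e (fun x => V (E (k, x)))
    (fun x => hV _) fun x y hxy => mul_conjTranspose_eq_zero_of_projections (hV _) (hV _) (by
      rw [hV', hV']
      refine hgg' _ _ ((hE (k, x)).trans (hE (k, y)).symm) fun h => hxy ?_
      exact congrArg Prod.snd (E.injective h))
  have hJ : {a} ⊆ r := Finset.singleton_subset_iff.2 ha
  let σ : ({a} : Finset (Fin n)) ↪ Fin m := ⟨fun _ => s₀, Function.injective_of_subsingleton _⟩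
  let X := fun p : κ × Bits ({a} : Finset (Fin n)) =>
    loadOp hJ hr' σ p.2 * (((Q p.1 : L (Bits (Fin m))) ⊗ₖ (1 : L (Bits r))) * W p.1)
  have hX : Realises fun l => X (E.symm l) :=
    ((hWr.unitary Q).load hJ hr' fun _ => σ).classical E E.symm E.apply_symm_apply
      fun k hk => absurd (E.symm_apply_apply k).symm hk
  have hUU : ∀ k, ((Q k : L (Bits (Fin m))) ⊗ₖ (1 : L (Bits r))) *
      ((Q k : L (Bits (Fin m))) ⊗ₖ (1 : L (Bits r)))ᴴ = 1 := fun k => by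
    have : (Q k : L (Bits (Fin m))) * (Q k : L (Bits (Fin m)))ᴴ = 1 :=
      mem_unitaryGroup_iff.1 (Q k).2
    rw [conjTranspose_kronecker, conjTranspose_one, ← mul_kronecker_mul, this, Matrix.one_mul,
      one_kronecker_one]
  refine ⟨fun l => X (E.symm l), hX, fun l => ?_, fun l => ?_, fun l i => ?_⟩
  · obtain ⟨⟨k, x⟩, rfl⟩ := E.surjective l
    simp only [X, E.symm_apply_apply]
    set A := loadOp hJ hr' σ x with hA
    set B := (Q k : L (Bits (Fin m))) ⊗ₖ (1 : L (Bits r)) with hB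
    calc A * (B * W k) * (A * (B * W k))ᴴ = A * (B * (W k * (W k)ᴴ) * Bᴴ) * Aᴴ := by
          simp only [conjTranspose_mul, Matrix.mul_assoc]
      _ = 1 := by
          rw [hW, Matrix.mul_one, hUU, Matrix.mul_one, loadOp_mul_conjTranspose]
  · obtain ⟨⟨k, x⟩, rfl⟩ := E.surjective l
    simp only [X, E.symm_apply_apply]
    set A := loadOp hJ hr' σ x with hA
    set B := (Q k : L (Bits (Fin m))) ⊗ₖ (1 : L (Bits r)) with hB
    have hk : f (E (k, x)) = k := hE _
    have hBAB : Bᴴ * (Aᴴ * A) * B = W k * F' (E (k, x)) * (W k)ᴴ := by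
      have h1 := hg (E (k, x))
      rw [hk] at h1
      rw [h1, hA, conjTranspose_mul_loadOp, hB, conjTranspose_kronecker, conjTranspose_one,
        ← mul_kronecker_mul, ← mul_kronecker_mul, Matrix.one_mul, Matrix.one_mul, ← hV', ← hQ]
      simp only [he]
      rfl
    calc (A * (B * W k))ᴴ * (A * (B * W k)) = (W k)ᴴ * (Bᴴ * (Aᴴ * A) * B) * W k := by
          simp only [conjTranspose_mul, Matrix.mul_assoc]
      _ = ((W k)ᴴ * W k) * F' (E (k, x)) * ((W k)ᴴ * W k) := by
          rw [hBAB]; simp only [Matrix.mul_assoc]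
      _ = F' (E (k, x)) := by
          have h1 := hFF' (E (k, x))
          have h2 := hF'F (E (k, x))
          rw [hk] at h1 h2
          rw [hWF, h1, h2]
  · have hi : i.1 ∈ r := (Finset.mem_sdiff.1 (hr'.subset i.2)).1
    exact (intertwines_loadOp hJ hr' _ _ i.1 hi i.2).mul
      ((intertwines_kronecker_one _ _).mul (hWi _ ⟨i.1, hi⟩))

/-! ### The final measurement -/

/-- The Kraus operator `(⟨k|_R ⊗ I) U`. -/
def krausOf {h r o : Type} (U : Matrix (r × o) h ℂ) (k : r) : Matrix o h ℂ :=
  Matrix.of fun i z => U (k, i) z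

theorem isCP_conjMap {h o : Type} [Fintype h] [Fintype o] (A : Matrix o h ℂ) : IsCP (conjMap A) := by
  intro n M hM
  have h1 : ampliate n (conjMap A) M =
      ((1 : L (Fin n)) ⊗ₖ A) * M * ((1 : L (Fin n)) ⊗ₖ A)ᴴ := by
    ext ⟨p, i⟩ ⟨q, j⟩
    simp only [ampliate, of_apply, conjMap_apply, Matrix.mul_apply, conjTranspose_apply,
      kronecker_apply, Fintype.sum_prod_type]
    rw [Finset.sum_eq_single q]
    · refine Finset.sum_congr rfl fun z _ => ?_
      rw [Finset.sum_eq_single p]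
      · simp
      · intro x _ hx
        simp [one_apply_ne hx.symm]
      · simp
    · intro x _ hx
      simp [one_apply_ne hx.symm]
    · simp
  rw [h1]
  exact hM.mul_mul_conjTranspose_same _

theorem sum_conjTranspose_mul_krausOf {h r o : Type} [Fintype r] [Fintype o] [DecidableEq h]
    {U : Matrix (r × o) h ℂ} (hU : Uᴴ * U = 1) :
    ∑ k, (krausOf U k)ᴴ * krausOf U k = 1 := by
  rw [← hU]
  ext i j
  rw [Matrix.sum_apply, Matrix.mul_apply, Fintype.sum_prod_type]
  rfl

theorem krausOf_mul_conjTranspose {h r o : Type} [Fintype h] [DecidableEq r] [DecidableEq o]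
    {U : Matrix (r × o) h ℂ} (hU : U * Uᴴ = 1) (k l : r) :
    krausOf U k * (krausOf U l)ᴴ = if k = l then 1 else 0 := by
  ext i j
  change (U * Uᴴ) (k, i) (l, j) = _
  rw [hU]
  by_cases h : k = l <;> simp [h, one_apply]

section Kraus

variable {h r o : Type} [Fintype h] [Fintype r] [Fintype o] [DecidableEq r] [DecidableEq o]

theorem unitaryMeasureInstr_eq_conjMap (U : Matrix (r × o) h ℂ) (k : r) :
    unitaryMeasureInstr U k = conjMap (krausOf U k) := by
  ext ρ i j
  change ∑ x : r, ((single k k (1 : ℂ) ⊗ₖ (1 : Matrix o o ℂ)) * (U * ρ * Uᴴ)) (x, i) (x, j) =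
    (U * ρ * Uᴴ) (k, i) (k, j)
  rw [Finset.sum_eq_single k]
  · rw [Matrix.mul_apply, Finset.sum_eq_single (k, i)]
    · simp
    · rintro ⟨x, y⟩ - hxy
      rw [kronecker_apply, single_apply, one_apply]
      by_cases hx : k = x
      · subst hx
        have hy : i ≠ y := fun h => hxy (by rw [h])
        rw [if_neg hy, mul_zero, zero_mul]
      · rw [if_neg (fun h => hx h.2), zero_mul, zero_mul]
    · simp
  · intro x _ hx
    rw [Matrix.mul_apply, Finset.sum_eq_zero]
    rintro ⟨x', y⟩ -
    rw [kronecker_apply, single_apply, if_neg (fun h => hx h.1.symm), zero_mul, zero_mul]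
  · simp

variable [DecidableEq h]

theorem isInstrument_unitaryMeasureInstr {U : Matrix (r × o) h ℂ} (hU : Uᴴ * U = 1) :
    IsInstrument (unitaryMeasureInstr U) := by
  refine ⟨fun k => ?_, fun ρ => ?_⟩
  · rw [unitaryMeasureInstr_eq_conjMap]
    exact isCP_conjMap _
  · simp only [unitaryMeasureInstr_eq_conjMap, conjMap_apply]
    rw [Finset.sum_congr rfl fun k _ => by
      rw [trace_mul_comm, ← Matrix.mul_assoc], ← trace_sum, ← Finset.sum_mul,
      sum_conjTranspose_mul_krausOf hU, Matrix.one_mul]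

theorem assocPOVM_unitaryMeasureInstr (U : Matrix (r × o) h ℂ) :
    assocPOVM (unitaryMeasureInstr U) = fun k => (krausOf U k)ᴴ * krausOf U k := by
  refine (assocPOVM_unique _ _ fun k ρ => ?_).symm
  rw [unitaryMeasureInstr_eq_conjMap, conjMap_apply, trace_mul_comm, ← Matrix.mul_assoc,
    trace_mul_comm, ← Matrix.mul_assoc]

theorem isProjectiveMeasurement_assocPOVM {U : Matrix (r × o) h ℂ} (hU₁ : Uᴴ * U = 1)
    (hU₂ : U * Uᴴ = 1) : IsProjectiveMeasurement (assocPOVM (unitaryMeasureInstr U)) := by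
  rw [assocPOVM_unitaryMeasureInstr]
  refine ⟨⟨fun k => posSemidef_conjTranspose_mul_self _, sum_conjTranspose_mul_krausOf hU₁⟩,
    fun k => ⟨?_, by simp⟩⟩
  rw [Matrix.mul_assoc, ← Matrix.mul_assoc (krausOf U k), krausOf_mul_conjTranspose hU₂, if_pos rfl,
    Matrix.one_mul]

theorem assocPOVM_unitaryMeasureInstr_ne_zero [Nonempty o] {U : Matrix (r × o) h ℂ}
    (hU : U * Uᴴ = 1) (k : r) : assocPOVM (unitaryMeasureInstr U) k ≠ 0 := fun h0 => by
  rw [assocPOVM_unitaryMeasureInstr, conjTranspose_mul_self_eq_zero] at h0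
  have h1 := krausOf_mul_conjTranspose hU k k
  rw [h0, Matrix.zero_mul, if_pos rfl] at h1
  exact zero_ne_one h1

end Kraus

/-- If the final Kraus operator is `B` on the output qubits with all other qubits in state `|0⟩`, then
tracing out the latter yields `ρ ↦ B ρ B†`. -/
theorem outTrace_conjMap {m n p : ℕ} (e : Fin m ≃ Fin p ⊕ Fin (m - p))
    (X : Matrix (Sys m (∅ : Finset (Fin n))) (Bits (Fin n)) ℂ)
    (B : Matrix (Bits (Fin p)) (Bits (Fin n)) ℂ)
    (hX : ∀ q z, X q z = if ∀ i, q.1 (e.symm (Sum.inr i)) = false then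
      B (fun i => q.1 (e.symm (Sum.inl i))) z else 0) (ρ : L (Bits (Fin n))) :
    outTrace e (conjMap X ρ) = conjMap B ρ := by
  have hX' : ∀ q q', conjMap X ρ q q' =
      if (∀ i, q.1 (e.symm (Sum.inr i)) = false) ∧ ∀ i, q'.1 (e.symm (Sum.inr i)) = false then
        conjMap B ρ (fun i => q.1 (e.symm (Sum.inl i))) (fun i => q'.1 (e.symm (Sum.inl i)))
      else 0 := fun q q' => by
    simp only [conjMap_apply, Matrix.mul_apply, conjTranspose_apply, hX]
    by_cases h1 : ∀ i, q.1 (e.symm (Sum.inr i)) = false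
    · by_cases h2 : ∀ i, q'.1 (e.symm (Sum.inr i)) = false
      · simp only [if_pos h1, if_pos h2, if_pos (And.intro h1 h2)]
      · simp only [if_neg h2, if_neg (fun h : _ ∧ _ => h2 h.2), star_zero, mul_zero,
          Finset.sum_const_zero]
    · simp only [if_neg h1, if_neg (fun h : _ ∧ _ => h1 h.1), zero_mul, Finset.sum_const_zero]
  ext o o'
  let glue : Bits (Fin p) → Bits (Fin (m - p)) → Bits (Fin m) := fun o y s => Sum.elim o y (e s)
  change ∑ y : Bits (Fin (m - p)), ∑ u : Bits (∅ : Finset (Fin n)),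
    conjMap X ρ (glue o y, u) (glue o' y, u) = _
  have hr : ∀ o y i, glue o y (e.symm (Sum.inr i)) = y i := fun o y i => by simp [glue]
  have hl : ∀ o y i, glue o y (e.symm (Sum.inl i)) = o i := fun o y i => by simp [glue]
  simp only [hX', hr, hl, Finset.univ_unique, Finset.sum_singleton, and_self]
  rw [Finset.sum_eq_single fun _ => false]
  · simp
  · intro y _ hy
    exact if_neg fun h => hy (funext h)
  · simp

/-- The measurement resets the qubits in `S`, and reads off `M` at the outcome `x`. -/
theorem measOp_kronecker_one_mul_apply {m n : ℕ} {r : Finset (Fin n)} {c : Type}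
    (S : Finset (Fin m)) (x : Bits S) (M : Matrix (Sys m r) c ℂ) (q : Sys m r) (z : c) :
    ((measOp S x ⊗ₖ (1 : L (Bits r))) * M) q z = if ∀ s : S, q.1 s = false then
      M (fun s => if h : s ∈ S then x ⟨s, h⟩ else q.1 s, q.2) z else 0 := by
  rw [Matrix.mul_apply,
    Finset.sum_eq_single ((fun s => if h : s ∈ S then x ⟨s, h⟩ else q.1 s, q.2) : Sys m r)]
  · rw [kronecker_apply, one_apply_eq, mul_one, measOp, of_apply]
    by_cases hq : ∀ s : S, q.1 s = false
    · rw [if_pos hq, if_pos, one_mul]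
      refine ⟨fun s => ⟨hq s, ?_⟩, fun s hs => ?_⟩
      · simp
      · simp [hs]
    · rw [if_neg hq, if_neg, zero_mul]
      exact fun h => hq fun s => (h.1 s).1
  · rintro ⟨y, u⟩ - hy
    rw [kronecker_apply, measOp, of_apply]
    by_cases hu : q.2 = u
    · subst hu
      rw [if_neg, zero_mul, zero_mul]
      rintro ⟨h1, h2⟩
      refine hy (Prod.ext (funext fun s => ?_) rfl)
      by_cases hs : s ∈ S
      · simpa [hs] using (h1 ⟨s, hs⟩).2
      · simpa [hs] using (h2 s hs).symm
    · rw [one_apply_ne hu, mul_zero, zero_mul]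
  · simp

/-- Once all the inputs are loaded, the refinement of the observed element of `F` into the elements
associated with the instrument is again a computational basis measurement up to a unitary, which can
be chosen to leave the output in the remaining qubits. -/
theorem Compresses.delayedImplementable {m n nR p : ℕ} {κ : Type} [Fintype κ] [DecidableEq κ]
    {F : κ → L (Bits (Fin n))} (h : Compresses m ∅ F)
    {U : Matrix (Bits (Fin nR) × Bits (Fin p)) (Bits (Fin n)) ℂ} (hU₁ : Uᴴ * U = 1)
    (hU₂ : U * Uᴴ = 1) (f : Bits (Fin nR) → κ)
    (hf : ∀ k, F k = ∑ l with f l = k, assocPOVM (unitaryMeasureInstr U) l) :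
    DelayedImplementable m (unitaryMeasureInstr U) := by
  refine ⟨isInstrument_unitaryMeasureInstr hU₁, ?_⟩
  have htrF := h.trace_eq
  obtain ⟨W, hWr, hW, hWF, -⟩ := h
  let B := krausOf U
  have hB : ∀ k, B k * (B k)ᴴ = 1 := fun k => by
    rw [krausOf_mul_conjTranspose hU₂, if_pos rfl]
  have hB' : ∀ k l, k ≠ l → B k * (B l)ᴴ = 0 := fun k l hkl => by
    rw [krausOf_mul_conjTranspose hU₂, if_neg hkl]
  have hBF : ∀ l, B l * F (f l) = B l := fun l => by
    rw [hf, Matrix.mul_sum, assocPOVM_unitaryMeasureInstr, Finset.sum_eq_single l]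
    · rw [← Matrix.mul_assoc, hB, Matrix.one_mul]
    · intro l' _ hl
      rw [← Matrix.mul_assoc, hB' _ _ hl.symm, Matrix.zero_mul]
    · simp
  -- the observed element has rank `2 ^ m`, and each of its refinements rank `2 ^ p`
  have hfib : ∀ k, (Finset.univ.filter fun l => f l = k).card * 2 ^ p = 2 ^ m := fun k => by
    have h1 : (F k).trace = (Finset.univ.filter fun l => f l = k).card * 2 ^ p := by
      rw [hf, trace_sum, assocPOVM_unitaryMeasureInstr, Finset.sum_congr rfl fun l _ => by
        rw [trace_mul_comm, hB, trace_one], Finset.sum_const, nsmul_eq_mul]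
      simp
    rw [htrF, Finset.card_empty, pow_zero, mul_one] at h1
    exact_mod_cast h1.symm
  have hp : p ≤ m := by
    have h1 := hfib (f fun _ => false)
    exact (Nat.pow_dvd_pow_iff_le_right (by norm_num)).1 (Dvd.intro_left _ h1)
  -- `S` is the set of slots to be measured; the others hold the output
  obtain ⟨S, -, hS⟩ := Finset.exists_subset_card_eq (s := (Finset.univ : Finset (Fin m)))
    (n := m - p) (by simp)
  have hSc : Fintype.card {s // s ∉ S} = p := by
    rw [Fintype.card_subtype_compl]
    simp [hS]
    omega
  let e₀ : S ≃ Fin (m - p) := Finset.equivFinOfCardEq hS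
  let e₁ : {s // s ∉ S} ≃ Fin p := Fintype.equivFinOfCardEq hSc
  let e : Fin m ≃ Fin p ⊕ Fin (m - p) :=
    (Equiv.sumCompl (· ∈ S)).symm.trans ((Equiv.sumCongr e₀ e₁).trans (Equiv.sumComm _ _))
  have hel : ∀ i, e.symm (Sum.inl i) = e₁.symm i := fun i => by simp [e]
  have her : ∀ i, e.symm (Sum.inr i) = e₀.symm i := fun i => by simp [e]
  let b : Bits (Fin m) ≃ Bits S × Bits (Fin p) :=
    (Equiv.piEquivPiSubtypeProd (· ∈ S) fun _ => Bool).trans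
      (Equiv.prodCongr (Equiv.refl _) (Equiv.arrowCongr e₁ (Equiv.refl _)))
  have hb₁ : ∀ y (s : S), (b y).1 s = y s := fun y s => rfl
  have hb₂ : ∀ y i, (b y).2 i = y (e₁.symm i) := fun y i => rfl
  obtain ⟨E, hE⟩ := exists_equiv_of_card_fiber (x := Bits S) f fun k => by
    have h1 := hfib k
    rw [← Nat.sub_add_cancel hp, pow_add] at h1
    rw [Nat.eq_of_mul_eq_mul_right (by positivity) h1]
    simp [hS]
  let ε : Bits (Fin m) ≃ Sys m (∅ : Finset (Fin n)) := (Equiv.prodUnique _ _).symm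
  let V : κ → Bits S → Matrix (Bits (Fin p)) (Bits (Fin m)) ℂ := fun k x =>
    (B (E (k, x)) * (W k)ᴴ).submatrix id ε
  have hVV : ∀ k x x', V k x * (V k x')ᴴ = B (E (k, x)) * (B (E (k, x')))ᴴ := fun k x x' => by
    have h1 := hBF (E (k, x))
    rw [hE] at h1
    simp only [V]
    rw [conjTranspose_submatrix, ← submatrix_mul _ _ _ ε _ ε.bijective, submatrix_id_id,
      conjTranspose_mul, conjTranspose_conjTranspose, Matrix.mul_assoc, ← Matrix.mul_assoc (W k)ᴴ,
      hWF, ← Matrix.mul_assoc, h1]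
  choose Q hQ _ using fun k => exists_unitary_of_coisometries b (V k)
    (fun x => by rw [hVV, hB]) fun x x' hx => by
      rw [hVV, hB' _ _ fun h => hx (congrArg Prod.snd (E.injective h))]
  -- the state after the unitary `Q k`
  have hQW : ∀ k q z, (((Q k : L (Bits (Fin m))) ⊗ₖ (1 : L (Bits (∅ : Finset (Fin n))))) * W k) q z
      = B (E (k, (b q.1).1)) (b q.1).2 z := fun k q z => by
    have h1 := hBF (E (k, (b q.1).1))
    rw [hE] at h1
    have h2 : B (E (k, (b q.1).1)) * (W k)ᴴ * W k = B (E (k, (b q.1).1)) := by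
      rw [Matrix.mul_assoc, hWF, h1]
    rw [← h2, Matrix.mul_apply, Matrix.mul_apply, ← Equiv.sum_comp ε]
    rw [← Equiv.sum_comp ε]
    refine Finset.sum_congr rfl fun y _ => ?_
    rw [kronecker_apply, hQ, one_apply, if_pos (Subsingleton.elim _ _), mul_one]
    rfl
  let E' : (Σ _ : κ, Bits S) ≃ Bits (Fin nR) := (Equiv.sigmaEquivProd _ _).trans E
  have hX := ((hWr.unitary Q).measure fun _ => S).classical E' E'.symm E'.apply_symm_apply
    fun k hk => absurd (E'.symm_apply_apply k).symm hk
  obtain ⟨C, hC⟩ := hX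
  refine ⟨Bits (Fin nR), Function.Embedding.refl _, C, e, fun l ρ => ?_⟩
  obtain ⟨⟨k, x⟩, rfl⟩ := E'.surjective l
  rw [unitaryMeasureInstr_eq_conjMap, Function.Embedding.refl_apply, hC]
  simp only [E'.symm_apply_apply]
  refine (outTrace_conjMap e _ _ (fun q z => ?_) ρ).symm
  rw [measOp_kronecker_one_mul_apply, hQW]
  simp only [hel, her]
  refine if_congr e₀.symm.surjective.forall ?_ rfl
  have h1 : (b fun s => if h : s ∈ S then x ⟨s, h⟩ else q.1 s).1 = x := by
    ext s
    simp [hb₁]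
  have h2 : (b fun s => if h : s ∈ S then x ⟨s, h⟩ else q.1 s).2 = fun i => q.1 (e₁.symm i) := by
    ext i
    simp [hb₂, (e₁.symm i).2]
  rw [h1, h2]
  rfl

/-! ### Chains of projective measurements -/

/-- In a chain of measurements each of which is a coarse-graining of the next, a measurement inherits
from its refinements that it acts trivially on a qubit. -/
theorem intertwines_of_chain {n T : ℕ} (A : Fin T → Fin n) {κ : Fin T → Type}
    [∀ t, Fintype (κ t)] [∀ t, DecidableEq (κ t)]
    {E : (t : Fin T) → κ t → L (Bits (Fin n))}
    (hchain : ∀ s t : Fin T, (t : ℕ) = (s : ℕ) + 1 →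
      ∃ f : κ t → κ s, ∀ k, E s k = ∑ l with f l = k, E t l)
    (hE : ∀ t k, Intertwines (Qubit.bits (A t)) (Qubit.bits (A t)) (E t k)) :
    ∀ (d : ℕ) (s t : Fin T), (t : ℕ) = s + d →
      ∀ k, Intertwines (Qubit.bits (A t)) (Qubit.bits (A t)) (E s k) := by
  intro d
  induction d with
  | zero =>
    intro s t hst k
    obtain rfl : t = s := Fin.ext hst
    exact hE t k
  | succ d ih =>
    intro s t hst k
    have hs : (s : ℕ) + 1 < T := by omega
    obtain ⟨f, hf⟩ := hchain s ⟨s + 1, hs⟩ rfl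
    rw [hf]
    exact .sum _ fun l _ => ih ⟨s + 1, hs⟩ t (by simp only; omega) l

/-- The input qubits that are not loaded after `t` rounds. -/
def unloadedFrom {n T : ℕ} (A : Fin T ↪ Fin n) (t : ℕ) : Finset (Fin n) :=
  (Finset.univ.filter fun i : Fin T => t ≤ i).map A

theorem mem_unloadedFrom {n T : ℕ} {A : Fin T ↪ Fin n} {t : ℕ} {q : Fin n} :
    q ∈ unloadedFrom A t ↔ ∃ i : Fin T, t ≤ i ∧ A i = q := by
  simp [unloadedFrom]

theorem unloadedFrom_succ {n T : ℕ} (A : Fin T ↪ Fin n) (t : Fin T) :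
    unloadedFrom A (t + 1) = unloadedFrom A t \ {A t} := by
  ext q
  simp only [Finset.mem_sdiff, mem_unloadedFrom, Finset.mem_singleton]
  constructor
  · rintro ⟨i, hi, rfl⟩
    refine ⟨⟨i, by omega, rfl⟩, fun h => ?_⟩
    have := A.injective h
    omega
  · rintro ⟨⟨i, hi, rfl⟩, hne⟩
    refine ⟨i, Nat.lt_of_le_of_ne hi fun h => hne ?_, rfl⟩
    rw [Fin.ext h]

theorem card_univ_sdiff_unloadedFrom_zero {n T : ℕ} (A : Fin T ↪ Fin n) :
    (Finset.univ \ unloadedFrom A 0).card = n - T := by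
  rw [Finset.card_univ_sdiff]
  simp [unloadedFrom]

theorem compresses_chain {n T : ℕ} (A : Fin T ↪ Fin n) {κ : Fin T → Type}
    [∀ t, Fintype (κ t)] [∀ t, DecidableEq (κ t)]
    {E : (t : Fin T) → κ t → L (Bits (Fin n))} (hproj : ∀ t, IsProjectiveMeasurement (E t))
    (hchain : ∀ s t : Fin T, (t : ℕ) = (s : ℕ) + 1 →
      ∃ f : κ t → κ s, ∀ k, E s k = ∑ l with f l = k, E t l)
    (hE : ∀ t k, Intertwines (Qubit.bits (A t)) (Qubit.bits (A t)) (E t k))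
    (hrank : ∀ t k, (E t k).rank = 2 ^ (n - ((t : ℕ) + 1))) :
    ∀ (t : ℕ) (ht : t < T), Compresses (n - T) (unloadedFrom A (t + 1)) (E ⟨t, ht⟩) := by
  have hTn : T ≤ n := by simpa using Fintype.card_le_of_embedding A
  have htr : ∀ t k, (E t k).trace = 2 ^ (n - ((t : ℕ) + 1)) := fun t k => by
    rw [trace_eq_rank ((hproj t).2 k).2 ((hproj t).2 k).1, hrank]
    norm_cast
  have htwo : ∀ t < T, (2 : ℂ) * 2 ^ (n - (t + 1)) = 2 ^ (n - t) := fun t ht => by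
    rw [← pow_succ']
    congr 1
    omega
  have hloc : ∀ (t : ℕ) (ht : t < T) l, ∀ i ∈ unloadedFrom A t,
      Intertwines (Qubit.bits i) (Qubit.bits i) (E ⟨t, ht⟩ l) := by
    intro t ht l i hi
    obtain ⟨j, hj, rfl⟩ := mem_unloadedFrom.1 hi
    exact intertwines_of_chain A hchain hE (j - t) ⟨t, ht⟩ j (by simp only; omega) l
  intro t
  induction t with
  | zero =>
    intro ht
    refine (compresses_one (unloadedFrom A 0) (card_univ_sdiff_unloadedFrom_zero A)).refine
      (a := A ⟨0, ht⟩) (mem_unloadedFrom.2 ⟨_, le_rfl, rfl⟩) (unloadedFrom_succ A ⟨0, ht⟩)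
      (hproj _) (fun _ => ()) (fun k => ?_) (fun k l => ?_) (hloc 0 ht)
    · simpa using (hproj ⟨0, ht⟩).1.2.symm
    · rw [htr, htwo 0 ht, trace_one]
      simp
  | succ t ih =>
    intro ht
    obtain ⟨f, hf⟩ := hchain ⟨t, by omega⟩ ⟨t + 1, ht⟩ rfl
    exact (ih (by omega)).refine (a := A ⟨t + 1, ht⟩) (mem_unloadedFrom.2 ⟨_, le_rfl, rfl⟩)
      (unloadedFrom_succ A ⟨t + 1, ht⟩) (hproj _) f hf
      (fun k l => by rw [htr, htr, htwo _ ht]) (hloc _ ht)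

end QubitSpace

theorem mainTheorem1
    (nin nR nout T : ℕ)
    (U : Matrix (QubitSpace.Bits (Fin nR) × QubitSpace.Bits (Fin nout))
      (QubitSpace.Bits (Fin nin)) ℂ)
    (hU₁ : U.conjTranspose * U = 1) (hU₂ : U * U.conjTranspose = 1)
    (A : Fin T ↪ Fin nin)
    (κ : Fin T → Type) [∀ t, Fintype (κ t)]
    (E : (t : Fin T) → κ t → QubitSpace.L (QubitSpace.Bits (Fin nin)))
    (hproj : ∀ t, QubitSpace.IsProjectiveMeasurement (E t))
    (hchain : ∀ s t : Fin T, (t : ℕ) = (s : ℕ) + 1 → QubitSpace.POVMComposable (E t) (E s))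
    (hlast : ∀ t : Fin T, (t : ℕ) + 1 = T →
      QubitSpace.POVMComposable
        (QubitSpace.assocPOVM (QubitSpace.unitaryMeasureInstr U)) (E t))
    (hns : ∀ t, QubitSpace.NoSignalingFromQubit (A t) (E t))
    (hrank : ∀ t k, (E t k).rank = 2 ^ (nin - ((t : ℕ) + 1))) :
    QubitSpace.DelayedImplementable (nin - T) (QubitSpace.unitaryMeasureInstr U) := by
  classical
  have hΛ := QubitSpace.isProjectiveMeasurement_assocPOVM hU₁ hU₂
  rcases T with _ | T
  · have h := QubitSpace.compresses_one (QubitSpace.unloadedFrom A 0)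
      (QubitSpace.card_univ_sdiff_unloadedFrom_zero A)
    have h0 : QubitSpace.unloadedFrom A 0 = ∅ := by
      ext; simp [QubitSpace.mem_unloadedFrom]
    rw [h0] at h
    exact h.delayedImplementable hU₁ hU₂ (fun _ => ()) fun k => by simpa using hΛ.1.2.symm
  · have hE0 : ∀ t k, E t k ≠ 0 := fun t k h => by
      have := hrank t k
      rw [h, Matrix.rank_zero] at this
      exact pow_ne_zero _ two_ne_zero this.symm
    have h := QubitSpace.compresses_chain A hproj
      (fun s t hst => (hchain s t hst).exists_coarseGraining (hproj t) (hproj s) (hE0 t))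
      (fun t => (hns t).intertwines) hrank T T.lt_succ_self
    have h0 : QubitSpace.unloadedFrom A (T + 1) = ∅ := by
      ext q
      simp only [QubitSpace.mem_unloadedFrom, Finset.notMem_empty, iff_false]
      rintro ⟨i, hi, -⟩
      omega
    rw [h0] at h
    obtain ⟨f, hf⟩ := (hlast ⟨T, T.lt_succ_self⟩ rfl).exists_coarseGraining hΛ (hproj _)
      (QubitSpace.assocPOVM_unitaryMeasureInstr_ne_zero hU₂)
    exact h.delayedImplementable hU₁ hU₂ f hf
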